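/- Let $\mathcal C$ be a fusion category over $\mathbb C$ and let $(f,\sigma_{-,f})$ be an object of its Drinfeld centre (so $\sigma_{V,f}:V\otimes f\to f\otimes V$ is a half braiding) which is a fermion: $f\otimes f\cong\mathbf 1$ and $\sigma_{f,f}=-\mathrm{id}_{f\otimes f}$. Let $\underline{\mathrm{Aut}_\otimes(\mathcal C,f)}$ be the monoidal category (with composition as tensor product) whose objects are the tensor autoequivalences $F$ of $\mathcal C$ that are fermionic, i.e. there is an isomorphism $\varphi:F(f)\to f$ under which $F(\sigma_{V,f})$ corresponds to $\sigma_{F(V),f}$ for all $V$, and whose morphisms are the tensor natural isomorphisms. Let $\mathrm{Aut}_\otimes(\mathcal C,f)$ be its group of isomorphism classes. Let $G$ be a group (for a super-group: a finite group), let $\underline G$ be the associated discrete monoidal category, let $\alpha\in H^2(G,\mathbb Z/2\mathbb Z)$, and let $\rho:G\to \mathrm{Aut}_\otimes(\mathcal C,f)$ be a group homomorphism. *Liftings.* A lifting of $\rho$ is a monoidal functor $\widetilde\rho:\underline G\to\underline{\mathrm{Aut}_\otimes(\mathcal C,f)}$, $g\mapsto g_*$, with tensor isomorphisms $\phi(g,h):(gh)_*\to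 g_*h_*$, such that the class of $\widetilde\rho(g)$ is $\rho(g)$ for all $g$. Two liftings are equivalent if they are isomorphic as monoidal functors. Each $g_*$ restricted to the subcategory $\langle f\rangle$ generated by $f$ is isomorphic, as a tensor functor, to the identity; choosing such isomorphisms $\xi_g$, and comparing $\xi_{gh}$ with the composite $(gh)_*\to g_*h_*\to g_*\to\mathrm{id}$ of $\phi(g,h)$, $\xi_h$ and $\xi_g$ at the object $f$, gives signs $\pm1$ that form a 2-cocycle of $G$, whose class is $\theta_{\widetilde\rho}\in H^2(G,\mathbb Z/2\mathbb Z)$. A lifting with $\theta_{\widetilde\rho}=\alpha$ is called an $\alpha$-lifting of $\rho$, or a fermionic action of $(G,\alpha)$ that realizes $\rho$. *Coefficients.* Let $\widehat{K_0(\mathcal C)}$ be the abelian group of functions $\chi:\mathrm{Irr}(\mathcal C)\to\mathbb C^\times$ with $\chi(Z)=\chi(X)\chi(Y)$ whenever the simple object $Z$ is a constituent of $X\otimes Y$; $G$ acts on it by $(g\chi)(X)=\chi(\rho(g)^{-1}X)$. Let $r:\widehat{K_0(\mathcal C)}\to\mathbb Z/2\mathbb Z$ be the restriction to $\langle f\rangle$,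 that is $\chi\mapsto\chi(f)\in\{\pm1\}\cong\mathbb Z/2\mathbb Z$, a homomorphism of $G$-modules, and let $r_*$ be the induced map on $H^2(G,-)$. If $r$ is nontrivial, let $d_2:H^2(G,\mathbb Z/2\mathbb Z)\to H^3(G,\mathrm{Ker}(r))$ be the connecting homomorphism of $1\to\mathrm{Ker}(r)\to\widehat{K_0(\mathcal C)}\to\mathbb Z/2\mathbb Z\to1$. *Obstruction.* For a lifting $\widetilde\rho$ of $\rho$ put $O_3(\widetilde\rho,\alpha)=\theta_{\widetilde\rho}/\alpha\in H^2(G,\mathbb Z/2\mathbb Z)$ if $r$ is trivial, and $O_3(\widetilde\rho,\alpha)=d_2(\theta_{\widetilde\rho}/\alpha)\in H^3(G,\mathrm{Ker}(r))$ if $r$ is nontrivial. *Twisting.* For $\beta\in H^2(G,\widehat{K_0(\mathcal C)})$ represented by a cocycle $b$, the twist $\beta\triangleright\widetilde\rho$ is the lifting, unique up to equivalence, with the same functors $g_*$ and with $\phi(g,h)_X$ replaced by $b(g,h)((gh)_*X)\,\phi(g,h)_X$ for simple objects $X$. **Theorem.** Suppose that $\rho$ has a lifting $\widetilde\rho$.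 Then: (a) $O_3(\widetilde\rho,\alpha)$ does not depend on the lifting: $O_3(\widetilde\rho{}',\alpha)=O_3(\widetilde\rho,\alpha)$ for every lifting $\widetilde\rho{}'$ of $\rho$. (b) $\rho$ is realized by a fermionic action of $(G,\alpha)$ if and only if $O_3(\widetilde\rho,\alpha)=0$. (c) The set of equivalence classes of $\alpha$-liftings of $\rho$ is a torsor (empty if the obstruction does not vanish) over $\mathrm{Ker}\big(r_*:H^2(G,\widehat{K_0(\mathcal C)})\to H^2(G,\mathbb Z/2\mathbb Z)\big)$: this group acts freely and transitively on it by $[\widetilde\rho]\mapsto[\beta\triangleright\widetilde\rho]$. -/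

import Mathlib

open CategoryTheory MonoidalCategory

universe v u

set_option linter.unusedSectionVars false
set_option linter.unusedSimpArgs false

namespace Fermionic

section Fusion

variable (C : Type u) [Category.{v} C]

/-- The setoid of isomorphism on the simple objects of `C`. -/
def simpleSetoid [Limits.HasZeroMorphisms C] : Setoid {X : C // Simple X} where
  r X Y := Nonempty (X.1 ≅ Y.1)
  iseqv := ⟨fun _ => ⟨Iso.refl _⟩, fun ⟨e⟩ => ⟨e.symm⟩, fun ⟨e⟩ ⟨e'⟩ => ⟨e ≪≫ e'⟩⟩

/-- A fusion category over `ℂ`: a `ℂ`-linear abelian (given by the instance arguments) semisimple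
rigid tensor category with finitely many isomorphism classes of simple objects, finite dimensional
spaces of morphisms and simple unit object. -/
class IsFusionCategory [Abelian C] [Linear ℂ C] [MonoidalCategory C] [MonoidalPreadditive C]
    [MonoidalLinear ℂ C] : Prop where
  rigid : Nonempty (RigidCategory C)
  finiteDimensional_hom : ∀ X Y : C, FiniteDimensional ℂ (X ⟶ Y)
  simple_unit : Simple (𝟙_ C)
  finite_simple : Finite (Quotient (simpleSetoid C))
  /-- Every object is a finite direct sum of simple objects. -/
  semisimple : ∀ X : C, ∃ (n : ℕ) (S : Fin n → C), (∀ i, Simple (S i)) ∧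
    ∃ b : Limits.Bicone S, Nonempty (b.pt ≅ X) ∧ Nonempty b.IsBilimit

end Fusion

section TensorAut

variable (C : Type u) [Category.{v} C] [Preadditive C] [Linear ℂ C] [MonoidalCategory C]

/-- A tensor autoequivalence of `C`: a `ℂ`-linear strong monoidal functor `C ⥤ C` which is an
equivalence. -/
structure TensorAut where
  functor : C ⥤ C
  [monoidal : functor.Monoidal]
  [isEquivalence : functor.IsEquivalence]
  [additive : functor.Additive]
  [linear : functor.Linear ℂ]

attribute [instance] TensorAut.monoidal TensorAut.isEquivalence TensorAut.additive
  TensorAut.linear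

variable {C}

namespace TensorAut

/-- Morphisms of tensor autoequivalences: tensor (i.e. monoidal) natural isomorphisms. -/
@[ext]
structure Hom (F G : TensorAut C) where
  iso : F.functor ≅ G.functor
  [isMonoidal : NatTrans.IsMonoidal iso.hom]

attribute [instance] Hom.isMonoidal

instance : Category (TensorAut C) where
  Hom F G := Hom F G
  id F := { iso := Iso.refl _, isMonoidal := inferInstanceAs (NatTrans.IsMonoidal (𝟙 F.functor)) }
  comp a b :=
    { iso := a.iso ≪≫ b.iso
      isMonoidal := inferInstanceAs (NatTrans.IsMonoidal (a.iso.hom ≫ b.iso.hom)) }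
  id_comp a := by apply Hom.ext; simp
  comp_id a := by apply Hom.ext; simp
  assoc a b c := by apply Hom.ext; simp

/-- The component at `X` of a morphism of tensor autoequivalences. -/
def app {F G : TensorAut C} (a : F ⟶ G) (X : C) : F.functor.obj X ⟶ G.functor.obj X :=
  (Hom.iso a).hom.app X

@[ext]
theorem hom_ext {F G : TensorAut C} {a b : F ⟶ G} (h : ∀ X, app a X = app b X) : a = b := by
  apply Hom.ext
  ext X
  exact h X

@[simp] theorem id_app (F : TensorAut C) (X : C) : app (𝟙 F) X = 𝟙 _ := rfl

@[simp] theorem comp_app {F G H : TensorAut C} (a : F ⟶ G) (b : G ⟶ H) (X : C) :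
    app (a ≫ b) X = app a X ≫ app b X := rfl

theorem id_iso (F : TensorAut C) : Hom.iso (𝟙 F) = Iso.refl _ := rfl

theorem comp_iso {F G H : TensorAut C} (a : F ⟶ G) (b : G ⟶ H) :
    Hom.iso (a ≫ b) = Hom.iso a ≪≫ Hom.iso b := rfl

theorem naturality {F G : TensorAut C} (a : F ⟶ G) {X Y : C} (p : X ⟶ Y) :
    F.functor.map p ≫ app a Y = app a X ≫ G.functor.map p :=
  (Hom.iso a).hom.naturality p

/-- Isomorphisms of tensor autoequivalences from monoidal natural isomorphisms. -/
def mkIso {F G : TensorAut C} (e : F.functor ≅ G.functor) [NatTrans.IsMonoidal e.hom] :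
    F ≅ G where
  hom := Hom.mk e
  inv := { iso := e.symm, isMonoidal := inferInstanceAs (NatTrans.IsMonoidal e.inv) }
  hom_inv_id := by apply Hom.ext; exact e.self_symm_id
  inv_hom_id := by apply Hom.ext; exact e.symm_self_id

theorem mkIso_iso {F G : TensorAut C} (e : F.functor ≅ G.functor) [NatTrans.IsMonoidal e.hom] :
    Hom.iso (mkIso e).hom = e := rfl

/-- The monoidal category `Aut_⊗(C)` of tensor autoequivalences; the tensor product `F ⊗ G` is the
composition `F ∘ G` (first `G`, then `F`) of tensor functors. -/
instance : MonoidalCategory (TensorAut C) where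
  tensorObj F G := { functor := G.functor ⋙ F.functor }
  tensorUnit := { functor := 𝟭 C }
  whiskerLeft F _ _ a :=
    { iso := Functor.isoWhiskerRight (Hom.iso a) F.functor
      isMonoidal := inferInstanceAs
        (NatTrans.IsMonoidal (Functor.whiskerRight (Hom.iso a).hom F.functor)) }
  whiskerRight a H :=
    { iso := Functor.isoWhiskerLeft H.functor (Hom.iso a)
      isMonoidal := inferInstanceAs
        (NatTrans.IsMonoidal (Functor.whiskerLeft H.functor (Hom.iso a).hom)) }
  associator F G H :=
    haveI : NatTrans.IsMonoidal (Functor.associator H.functor G.functor F.functor).symm.hom :=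
      inferInstanceAs (NatTrans.IsMonoidal (Functor.associator _ _ _).inv)
    mkIso (Functor.associator H.functor G.functor F.functor).symm
  leftUnitor F :=
    mkIso (F := { functor := F.functor ⋙ 𝟭 C }) F.functor.rightUnitor
  rightUnitor F :=
    mkIso (F := { functor := 𝟭 C ⋙ F.functor }) F.functor.leftUnitor
  tensorHom_def := by intros; rfl
  id_tensorHom_id := by intros; ext; simp [app, id_iso, comp_iso, mkIso_iso]
  tensorHom_comp_tensorHom := by intros; ext; simp [app, id_iso, comp_iso, mkIso_iso]
  whiskerLeft_id := by intros; ext; simp [app, id_iso, comp_iso, mkIso_iso]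
  id_whiskerRight := by intros; ext; simp [app, id_iso, comp_iso, mkIso_iso]
  associator_naturality := by intros; ext; simp [app, id_iso, comp_iso, mkIso_iso]
  leftUnitor_naturality := by intros; ext; simp [app, id_iso, comp_iso, mkIso_iso]
  rightUnitor_naturality := by intros; ext; simp [app, id_iso, comp_iso, mkIso_iso]
  pentagon := by intros; ext; simp [app, id_iso, comp_iso, mkIso_iso]
  triangle := by intros; ext; simp [app, id_iso, comp_iso, mkIso_iso]

@[simp] theorem tensor_whiskerLeft_app (F : TensorAut C) {G H : TensorAut C} (a : G ⟶ H) (X : C) :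
    app (F ◁ a) X = F.functor.map (app a X) := rfl

@[simp] theorem tensor_whiskerRight_app {F G : TensorAut C} (a : F ⟶ G) (H : TensorAut C) (X : C) :
    app (a ▷ H) X = app a (H.functor.obj X) := rfl

@[simp] theorem associator_hom_app (F G H : TensorAut C) (X : C) :
    app (α_ F G H).hom X = 𝟙 _ := rfl

end TensorAut

end TensorAut
section Fermion

open Functor.OplaxMonoidal

variable {C : Type u} [Category.{v} C] [Abelian C] [Linear ℂ C] [MonoidalCategory C]

/-- For an object `(f, σ)` of the Drinfeld centre (a pair of `f : C` and a half braiding on `f`),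
the morphism `σ_{V,f} : V ⊗ f ⟶ f ⊗ V`. (Mathlib stores the inverse family `f ⊗ V ≅ V ⊗ f`.) -/
def halfBraid {f : C} (σ : HalfBraiding f) (V : C) : V ⊗ f ⟶ f ⊗ V := (σ.β V).inv

/-- A fermion: an object `(f, σ)` of the Drinfeld centre with `f ⊗ f ≅ 𝟙` and `σ_{f,f} = -id`. A
fermionic fusion category is a fusion category with a fermion. -/
structure IsFermion {f : C} (σ : HalfBraiding f) : Prop where
  sq_iso_unit : Nonempty (f ⊗ f ≅ 𝟙_ C)
  halfBraid_self : halfBraid σ f = -𝟙 (f ⊗ f)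

/-- Fermionic tensor autoequivalences: tensor autoequivalences `F` with an isomorphism
`φ : F f ≅ f` under which `F σ_{V,f}` corresponds to `σ_{F V,f}` for all `V`. -/
def isFermionic {f : C} (σ : HalfBraiding f) : ObjectProperty (TensorAut C) := fun F =>
  ∃ φ : F.functor.obj f ≅ f, ∀ V : C,
    F.functor.map (halfBraid σ V) ≫ δ F.functor f V ≫ φ.hom ▷ F.functor.obj V =
      δ F.functor V f ≫ F.functor.obj V ◁ φ.hom ≫ halfBraid σ (F.functor.obj V)

instance {f : C} (σ : HalfBraiding f) : (isFermionic σ).IsMonoidal where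
  prop_unit := ⟨Iso.refl _, fun V => by
    change halfBraid σ V ≫ 𝟙 _ ≫ 𝟙 f ▷ V = 𝟙 _ ≫ V ◁ 𝟙 f ≫ halfBraid σ V
    simp⟩
  prop_tensor F G := by
    rintro ⟨φ, hφ⟩ ⟨ψ, hψ⟩
    refine ⟨F.functor.mapIso ψ ≪≫ φ, fun V => ?_⟩
    change F.functor.map (G.functor.map (halfBraid σ V)) ≫
        (F.functor.map (δ G.functor f V) ≫ δ F.functor _ _) ≫
          (F.functor.map ψ.hom ≫ φ.hom) ▷ F.functor.obj (G.functor.obj V) =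
      (F.functor.map (δ G.functor V f) ≫ δ F.functor _ _) ≫
        F.functor.obj (G.functor.obj V) ◁ (F.functor.map ψ.hom ≫ φ.hom) ≫
          halfBraid σ (F.functor.obj (G.functor.obj V))
    simp only [comp_whiskerRight, MonoidalCategory.whiskerLeft_comp, Category.assoc]
    rw [δ_natural_left_assoc, δ_natural_right_assoc, ← hφ, ← Functor.map_comp_assoc,
      ← Functor.map_comp_assoc, ← Functor.map_comp_assoc, ← Functor.map_comp_assoc]
    rw [Category.assoc, hψ V]
    simp

/-- The monoidal category `Aut_⊗(C, f)`: the full monoidal subcategory of `Aut_⊗(C)` on the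
fermionic tensor autoequivalences. -/
abbrev FermAut {f : C} (σ : HalfBraiding f) := (isFermionic σ).FullSubcategory

/-- The group `Aut_⊗(C, f)` of isomorphism classes of fermionic tensor autoequivalences, with
composition as multiplication. (Only the monoid structure is needed in order to speak of
homomorphisms from a group to it.) -/
abbrev FermAutClasses {f : C} (σ : HalfBraiding f) := Skeleton (FermAut σ)

end Fermion

section Characters

variable (C : Type u) [Category.{v} C] [Abelian C] [Linear ℂ C] [MonoidalCategory C]
  [MonoidalPreadditive C] [MonoidalLinear ℂ C] [IsFusionCategory C]

instance : Finite (Quotient (simpleSetoid C)) := IsFusionCategory.finite_simple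

/-- `Irr(C)`, the set of isomorphism classes of simple objects. As a finite set it has a copy in
`Type`; that copy is used, because group cohomology takes coefficients there. -/
def Irr : Type := Shrink.{0} (Quotient (simpleSetoid C))

/-- The bijection between the isomorphism classes of simple objects and their copy `Irr C`. -/
noncomputable def Irr.equiv : Quotient (simpleSetoid C) ≃ Irr C := equivShrink _

variable {C}

/-- The class of a simple object. -/
noncomputable def Irr.mk (X : C) (hX : Simple X) : Irr C :=
  Irr.equiv C (Quotient.mk (simpleSetoid C) ⟨X, hX⟩)

theorem Irr.mk_eq_mk {X Y : C} (hX : Simple X) (hY : Simple Y) :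
    Irr.mk X hX = Irr.mk Y hY ↔ Nonempty (X ≅ Y) := by
  unfold Irr.mk
  rw [(Irr.equiv C).apply_eq_iff_eq]
  exact Quotient.eq (r := simpleSetoid C)

theorem Irr.ind {P : Irr C → Prop} (h : ∀ (X : C) (hX : Simple X), P (Irr.mk X hX)) (i : Irr C) :
    P i := by
  obtain ⟨q, rfl⟩ := (Irr.equiv C).surjective i
  induction q using Quotient.inductionOn with
  | h X => exact h X.1 X.2

variable (C) in
/-- The group of characters of the Grothendieck ring `K₀(C)`: functions `χ : Irr(C) → ℂˣ` that are
multiplicative for the tensor product, i.e. `χ(Z) = χ(X) χ(Y)` for every simple constituent `Z` of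
`X ⊗ Y`, where `X` and `Y` are simple. -/
def K0hat : Subgroup (Irr C → ℂˣ) where
  carrier := {χ | ∀ (X Y Z : C) (hX : Simple X) (hY : Simple Y) (hZ : Simple Z),
    (∃ i : Z ⟶ X ⊗ Y, i ≠ 0) → χ (Irr.mk Z hZ) = χ (Irr.mk X hX) * χ (Irr.mk Y hY)}
  one_mem' := by intros; simp
  mul_mem' {a b} ha hb X Y Z hX hY hZ h := by
    simp only [Pi.mul_apply, ha X Y Z hX hY hZ h, hb X Y Z hX hY hZ h]
    exact mul_mul_mul_comm _ _ _ _
  inv_mem' {a} ha X Y Z hX hY hZ h := by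
    simp only [Pi.inv_apply, ha X Y Z hX hY hZ h, mul_inv]

theorem simple_functor_obj (F : TensorAut C) {X : C} (hX : Simple X) :
    Simple (F.functor.obj X) :=
  simple_obj F.functor X

/-- The action of a tensor autoequivalence on `Irr(C)`. -/
noncomputable def irrMap (F : TensorAut C) (i : Irr C) : Irr C :=
  Quotient.lift (s := simpleSetoid C)
    (fun X => Irr.mk (F.functor.obj X.1) (simple_functor_obj F X.2))
    (fun _ _ ⟨e⟩ => (Irr.mk_eq_mk _ _).2 ⟨F.functor.mapIso e⟩) ((Irr.equiv C).symm i)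

theorem irrMap_mk (F : TensorAut C) (X : C) (hX : Simple X) :
    irrMap F (Irr.mk X hX) = Irr.mk (F.functor.obj X) (simple_functor_obj F hX) := by
  unfold irrMap Irr.mk
  rw [Equiv.symm_apply_apply]
  rfl

theorem irrMap_congr {F G : TensorAut C} (e : F ≅ G) : irrMap F = irrMap G := by
  funext i
  induction i using Irr.ind with
  | h X hX =>
    rw [irrMap_mk, irrMap_mk, Irr.mk_eq_mk]
    exact ⟨(TensorAut.Hom.iso e.hom).app X⟩

/-- Pull back of characters along a tensor autoequivalence, `χ ↦ (X ↦ χ(F X))`. -/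
noncomputable def K0hat.pullback (F : TensorAut C) : K0hat C →* K0hat C where
  toFun χ := ⟨fun i => χ.1 (irrMap F i), fun X Y Z hX hY hZ ⟨i, hi⟩ => by
    simp only [irrMap_mk]
    refine χ.2 _ _ _ _ _ _
      ⟨F.functor.map i ≫ Functor.OplaxMonoidal.δ F.functor X Y, fun h => hi ?_⟩
    rw [← F.functor.map_eq_zero_iff]
    rwa [← Limits.zero_comp (f := Functor.OplaxMonoidal.δ F.functor X Y), cancel_mono] at h⟩
  map_one' := rfl
  map_mul' _ _ := rfl

end Characters
section Coefficients

variable {C : Type u} [Category.{v} C] [Abelian C] [Linear ℂ C] [MonoidalCategory C]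
  [MonoidalPreadditive C] [MonoidalLinear ℂ C] [IsFusionCategory C]

theorem K0hat.pullback_congr {F G : TensorAut C} (h : Nonempty (F ≅ G)) :
    K0hat.pullback F = K0hat.pullback G := by
  obtain ⟨e⟩ := h
  ext χ : 1
  apply Subtype.ext
  funext i
  change χ.1 (irrMap F i) = χ.1 (irrMap G i)
  rw [irrMap_congr e]

theorem K0hat.pullback_tensor (F G : TensorAut C) (χ : K0hat C) :
    K0hat.pullback (F ⊗ G) χ = K0hat.pullback G (K0hat.pullback F χ) := by
  apply Subtype.ext
  funext i
  change χ.1 (irrMap (F ⊗ G) i) = χ.1 (irrMap F (irrMap G i))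
  congr 1
  induction i using Irr.ind with
  | h X hX => simp only [irrMap_mk]; rfl

theorem K0hat.pullback_unit (χ : K0hat C) : K0hat.pullback (𝟙_ (TensorAut C)) χ = χ := by
  apply Subtype.ext
  funext i
  change χ.1 (irrMap (𝟙_ (TensorAut C)) i) = χ.1 i
  congr 1
  induction i using Irr.ind with
  | h X hX => simp only [irrMap_mk]; rfl

variable {f : C} {σ : HalfBraiding f} {G : Type} [Group G]

/-- A chosen fermionic tensor autoequivalence in a given class. -/
noncomputable def FermAutClasses.rep (c : FermAutClasses σ) : TensorAut C :=
  ((fromSkeleton (FermAut σ)).obj c).obj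

theorem FermAutClasses.rep_iso {c : FermAutClasses σ} {F : FermAut σ} (h : toSkeleton F = c) :
    Nonempty (c.rep ≅ F.obj) := by
  subst h
  exact ⟨(isFermionic σ).ι.mapIso (fromSkeletonToSkeletonIso F)⟩

theorem FermAutClasses.rep_mul (c d : FermAutClasses σ) :
    Nonempty ((c * d).rep ≅ c.rep ⊗ d.rep) :=
  FermAutClasses.rep_iso (F := (fromSkeleton (FermAut σ)).obj c ⊗ (fromSkeleton (FermAut σ)).obj d)
    (Skeleton.mul_eq c d).symm

theorem FermAutClasses.rep_one : Nonempty ((1 : FermAutClasses σ).rep ≅ 𝟙_ (TensorAut C)) :=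
  FermAutClasses.rep_iso (F := 𝟙_ (FermAut σ)) Skeleton.one_eq.symm

/-- The `G`-module structure on the character group (written additively) given by
`ρ : G → Aut_⊗(C, f)`, namely `(g χ)(X) = χ(ρ(g)⁻¹ X)`. -/
noncomputable def charRep (ρ : G →* FermAutClasses σ) : Rep ℤ G :=
  Rep.of (X := Additive (K0hat C))
    { toFun g := (K0hat.pullback (ρ g⁻¹).rep).toAdditive.toIntLinearMap
      map_one' := by
        ext χ : 1
        change K0hat.pullback (ρ 1⁻¹).rep χ.toMul = χ.toMul
        rw [inv_one, map_one, K0hat.pullback_congr FermAutClasses.rep_one, K0hat.pullback_unit]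
      map_mul' g h := by
        ext χ : 1
        change K0hat.pullback (ρ (g * h)⁻¹).rep χ.toMul =
          K0hat.pullback (ρ g⁻¹).rep (K0hat.pullback (ρ h⁻¹).rep χ.toMul)
        rw [mul_inv_rev, map_mul, K0hat.pullback_congr (FermAutClasses.rep_mul _ _),
          K0hat.pullback_tensor] }

variable (G) in
/-- The group `ℤ/2ℤ` with trivial `G`-action. -/
noncomputable abbrev zmodTwoRep : Rep ℤ G := Rep.trivial ℤ G (ZMod 2)

namespace IsFermion

theorem simple (hf : IsFermion σ) : Simple f := by
  obtain ⟨e⟩ := hf.sq_iso_unit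
  let i : tensorLeft f ⋙ tensorLeft f ≅ 𝟭 C :=
    (tensorLeftTensor f f).symm ≪≫ (tensoringLeft C).mapIso e ≪≫ leftUnitorNatIso C
  have : (tensorLeft f).IsEquivalence :=
    (CategoryTheory.Equivalence.mk (tensorLeft f) (tensorLeft f) i.symm i).isEquivalence_functor
  have : Simple (𝟙_ C) := IsFusionCategory.simple_unit
  have : Simple (f ⊗ 𝟙_ C) := simple_obj (tensorLeft f) (𝟙_ C)
  exact Simple.of_iso (ρ_ f).symm

/-- The class of the fermion in `Irr(C)`. -/
noncomputable def cls (hf : IsFermion σ) : Irr C := Irr.mk f hf.simple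

theorem char_sq (hf : IsFermion σ) (χ : K0hat C) : χ.1 hf.cls * χ.1 hf.cls = 1 := by
  have h1 : Simple (𝟙_ C) := IsFusionCategory.simple_unit
  have key : χ.1 (Irr.mk (𝟙_ C) h1) = 1 := by
    have h := χ.2 (𝟙_ C) (𝟙_ C) (𝟙_ C) h1 h1 h1 ⟨(λ_ (𝟙_ C)).inv, fun h0 => id_nonzero (𝟙_ C) (by
      rw [← (λ_ (𝟙_ C)).inv_hom_id, h0, Limits.zero_comp])⟩
    exact (mul_eq_left.1 h.symm)
  obtain ⟨e⟩ := hf.sq_iso_unit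
  rw [← key]
  exact (χ.2 f f (𝟙_ C) hf.simple hf.simple h1 ⟨e.inv, fun h0 => id_nonzero (𝟙_ C) (by
      rw [← e.inv_hom_id, h0, Limits.zero_comp])⟩).symm

theorem irrMap_cls (hf : IsFermion σ) (F : FermAut σ) : irrMap F.obj hf.cls = hf.cls := by
  obtain ⟨φ, -⟩ := F.property
  unfold cls
  rw [irrMap_mk, Irr.mk_eq_mk]
  exact ⟨φ⟩

open Classical in
/-- The restriction `χ ↦ χ|⟨f⟩` of characters of `K₀(C)` to `⟨f⟩`, the latter characters being
identified with `ℤ/2ℤ`: such a character is given by its value `χ(f) = ±1`. -/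
noncomputable def restrictHom (hf : IsFermion σ) : Additive (K0hat C) →+ ZMod 2 where
  toFun χ := if χ.toMul.1 hf.cls = 1 then 0 else 1
  map_zero' := if_pos rfl
  map_add' χ ψ := by
    have h (χ : K0hat C) : χ.1 hf.cls = 1 ∨ χ.1 hf.cls = -1 := by
      have h2 := congrArg Units.val (hf.char_sq χ)
      rcases mul_self_eq_one_iff.1 h2 with h | h
      · exact Or.inl (Units.ext h)
      · exact Or.inr (Units.ext h)
    have hne : (-1 : ℂˣ) ≠ 1 := fun h => by
      have := congrArg Units.val h
      norm_num at this
    have hmul : (χ + ψ).toMul.1 hf.cls = χ.toMul.1 hf.cls * ψ.toMul.1 hf.cls := rfl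
    rw [hmul]
    rcases h χ.toMul with h1 | h1 <;> rcases h ψ.toMul with h2 | h2 <;> rw [h1, h2] <;>
      simp [hne] <;> decide

/-- The restriction map `r` as a homomorphism of `G`-modules. -/
noncomputable def restrict (hf : IsFermion σ) (ρ : G →* FermAutClasses σ) :
    charRep ρ ⟶ zmodTwoRep G :=
  Rep.ofHom
    { toLinearMap := hf.restrictHom.toIntLinearMap
      isIntertwining' := fun g => by
        ext χ : 1
        classical
        change (if χ.toMul.1 (irrMap (ρ g⁻¹).rep hf.cls) = 1 then (0 : ZMod 2) else 1) =
          if χ.toMul.1 hf.cls = 1 then 0 else 1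
        rw [show irrMap (ρ g⁻¹).rep hf.cls = hf.cls from
          hf.irrMap_cls ((fromSkeleton (FermAut σ)).obj (ρ g⁻¹))] }

/-- `r_* : H²(G, K₀(C)^) → H²(G, ℤ/2ℤ)`. -/
noncomputable def restrictH2 (hf : IsFermion σ) (ρ : G →* FermAutClasses σ) :
    groupCohomology (charRep ρ) 2 ⟶ groupCohomology (zmodTwoRep G) 2 :=
  groupCohomology.map (MonoidHom.id G) (hf.restrict ρ) 2

/-- `r` is trivial. -/
def RestrictTrivial (hf : IsFermion σ) : Prop := hf.restrictHom = 0

/-- The sequence `0 → Ker r → K₀(C)^ → ℤ/2ℤ → 0` of `G`-modules. -/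
noncomputable def restrictSequence (hf : IsFermion σ) (ρ : G →* FermAutClasses σ) :
    ShortComplex (Rep ℤ G) :=
  ShortComplex.mk (Limits.kernel.ι (hf.restrict ρ)) (hf.restrict ρ) (Limits.kernel.condition _)

theorem restrictSequence_shortExact (hf : IsFermion σ) (ρ : G →* FermAutClasses σ)
    (h : ¬ hf.RestrictTrivial) : (hf.restrictSequence ρ).ShortExact where
  exact := ShortComplex.exact_of_f_is_kernel _ (Limits.kernelIsKernel (hf.restrict ρ))
  mono_f := by
    unfold restrictSequence
    exact inferInstanceAs (Mono (Limits.kernel.ι (hf.restrict ρ)))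
  epi_g := by
    apply (Rep.epi_iff_surjective _).2
    obtain ⟨χ, hχ⟩ : ∃ χ, hf.restrictHom χ ≠ 0 := by
      by_contra! hc
      exact h (AddMonoidHom.ext hc)
    intro (y : ZMod 2)
    change ∃ a, hf.restrictHom a = y
    have hχ1 : hf.restrictHom χ = 1 := by
      revert hχ; generalize hf.restrictHom χ = z; revert z; decide
    obtain rfl | rfl : y = 0 ∨ y = 1 := by revert y; decide
    · exact ⟨0, map_zero _⟩
    · exact ⟨χ, hχ1⟩

/-- For nontrivial `r`, the connecting homomorphism `d₂ : H²(G, ℤ/2ℤ) → H³(G, Ker r)` of the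
sequence `0 → Ker r → K₀(C)^ → ℤ/2ℤ → 0`. -/
noncomputable def connecting (hf : IsFermion σ) (ρ : G →* FermAutClasses σ)
    (h : ¬ hf.RestrictTrivial) :
    groupCohomology (zmodTwoRep G) 2 ⟶ groupCohomology (Limits.kernel (hf.restrict ρ)) 3 :=
  groupCohomology.δ (hf.restrictSequence_shortExact ρ h) 2 3 rfl

end IsFermion

end Coefficients
section Actions

open Functor.OplaxMonoidal

variable {C : Type u} [Category.{v} C] [Abelian C] [Linear ℂ C] [MonoidalCategory C]
  {f : C} {σ : HalfBraiding f} {G : Type} [Group G]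

/-- For an action `L` (a monoidal functor from the discrete monoidal category `G` to
`Aut_⊗(C, f)`), the tensor autoequivalence `g_*`. -/
abbrev act (L : Discrete G ⥤ FermAut σ) (g : G) : C ⥤ C := (L.obj ⟨g⟩).obj.functor

/-- The tensor natural isomorphism `φ(g,h) : (gh)_* ⟶ g_* ∘ h_*` of an action, at an object `X`. -/
def actSplit (L : Discrete G ⥤ FermAut σ) [L.Monoidal] (g h : G) (X : C) :
    (act L (g * h)).obj X ⟶ (act L g).obj ((act L h).obj X) :=
  TensorAut.app (δ L ⟨g⟩ ⟨h⟩).hom X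

/-- The isomorphisms `u : F f ≅ f` that come from the tensor isomorphisms between the restriction
of a tensor functor `F` to `⟨f⟩` and the inclusion of `⟨f⟩`: as `⟨f⟩` is generated by `f` (with
`f ⊗ f ≅ 𝟙`), such a tensor isomorphism `ξ` is determined by `u = ξ_f`; its values on `f ⊗ f` and
`𝟙` are prescribed by `u ⊗ u` and the unit constraint, and it has to be natural for the morphisms
`f ⊗ f ⟶ 𝟙`. -/
def IsTensorTrivialization (F : C ⥤ C) [F.Monoidal] (u : F.obj f ≅ f) : Prop :=
  ∀ e : f ⊗ f ⟶ 𝟙_ C, δ F f f ≫ (u.hom ⊗ₘ u.hom) ≫ e = F.map e ≫ η F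

/-- Data describing the restriction of an action to `⟨f⟩` as a `2`-cochain: tensor isomorphisms
`ξ_g : g_*|⟨f⟩ ≅ id` (given by `u g = ξ_g` at `f`) and the resulting tensor automorphisms
`c(g,h) = ± 1` of the identity of `⟨f⟩` which compare `ξ_{gh}` with the composite
`(gh)_* → g_* h_* → g_* → id` of `φ(g,h)`, `ξ_h` and `ξ_g`. The sign `(-1) ^ c(g,h)` is its
value on `f`. -/
structure RestrictionCochain (L : Discrete G ⥤ FermAut σ) [L.Monoidal] where
  u : ∀ g, (act L g).obj f ≅ f
  tensor : ∀ g, IsTensorTrivialization (act L g) (u g)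
  c : G × G → ZMod 2
  compare : ∀ g h, (u (g * h)).hom =
    (-1 : ℂ) ^ (c (g, h)).val • (actSplit L g h f ≫ (act L g).map (u h).hom ≫ (u g).hom)

theorem IsTensorTrivialization.of_nat {F H : TensorAut C} (t : F ⟶ H)
    {u : H.functor.obj f ≅ f} (hu : IsTensorTrivialization H.functor u)
    {v : F.functor.obj f ≅ f} (hv : v.hom = TensorAut.app t f ≫ u.hom) :
    IsTensorTrivialization F.functor v := by
  intro e
  have hδ : δ F.functor f f ≫ (TensorAut.app t f ⊗ₘ TensorAut.app t f) =
      TensorAut.app t (f ⊗ f) ≫ δ H.functor f f := by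
    have h := NatTrans.IsMonoidal.tensor (τ := (TensorAut.Hom.iso t).hom) f f
    rw [← cancel_mono (Functor.LaxMonoidal.μ H.functor f f), Category.assoc, Category.assoc]
    rw [Functor.Monoidal.δ_μ, Category.comp_id]
    erw [← h]
    erw [Functor.Monoidal.δ_μ_assoc]
    rfl
  have hη : TensorAut.app t (𝟙_ C) ≫ η H.functor = η F.functor := by
    have h := NatTrans.IsMonoidal.unit (τ := (TensorAut.Hom.iso t).hom)
    rw [← cancel_mono (Functor.LaxMonoidal.ε H.functor), Category.assoc,
      Functor.Monoidal.η_ε, Category.comp_id, ← h]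
    erw [Functor.Monoidal.η_ε_assoc]
    rfl
  rw [hv, ← tensorHom_comp_tensorHom, Category.assoc, reassoc_of% hδ, hu e,
    ← hη]
  exact ((reassoc_of% (TensorAut.naturality t e)) _).symm

theorem IsTensorTrivialization.comp {F H : C ⥤ C} [F.Monoidal] [H.Monoidal]
    {u : F.obj f ≅ f} (hu : IsTensorTrivialization F u)
    {v : H.obj f ≅ f} (hv : IsTensorTrivialization H v) :
    IsTensorTrivialization (H ⋙ F) (F.mapIso v ≪≫ u) := by
  intro e
  change (F.map (δ H f f) ≫ δ F _ _) ≫ ((F.map v.hom ≫ u.hom) ⊗ₘ (F.map v.hom ≫ u.hom)) ≫ e =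
    F.map (H.map e) ≫ F.map (η H) ≫ η F
  rw [← tensorHom_comp_tensorHom, Category.assoc, Category.assoc, δ_natural_assoc, hu e,
    ← Functor.map_comp_assoc, ← Functor.map_comp_assoc, ← Functor.map_comp_assoc, Category.assoc,
    hv e]

variable [MonoidalPreadditive C] [MonoidalLinear ℂ C] [IsFusionCategory C]

theorem exists_smul_id {X : C} (hX : Simple X) (p : X ⟶ X) : ∃ c : ℂ, p = c • 𝟙 X := by
  have := IsFusionCategory.finiteDimensional_hom X X
  obtain ⟨c, hc⟩ := endomorphism_simple_eq_smul_id ℂ p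
  exact ⟨c, hc.symm⟩

theorem exists_smul_eq {X Y : C} (hY : Simple Y) (p q : X ≅ Y) :
    ∃ c : ℂ, p.hom = c • q.hom := by
  obtain ⟨c, hc⟩ := exists_smul_id hY (q.inv ≫ p.hom)
  refine ⟨c, ?_⟩
  rw [← cancel_epi q.inv, hc]
  simp

theorem smul_hom_injective {X Y : C} (hY : Simple Y) (p : X ≅ Y) {a b : ℂ}
    (h : a • p.hom = b • p.hom) : a = b := by
  have h2 : (a - b) • 𝟙 Y = 0 := by
    rw [sub_smul, sub_eq_zero, ← p.inv_hom_id, ← Linear.comp_smul, h, Linear.comp_smul]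
  rcases smul_eq_zero.1 h2 with h3 | h3
  · exact sub_eq_zero.1 h3
  · exact absurd h3 (id_nonzero Y)

namespace IsFermion

theorem exists_trivialization (hf : IsFermion σ) (F : FermAut σ) :
    ∃ u : F.obj.functor.obj f ≅ f, IsTensorTrivialization F.obj.functor u := by
  obtain ⟨u₀, -⟩ := F.property
  obtain ⟨e₀⟩ := hf.sq_iso_unit
  have h1 : Simple (𝟙_ C) := IsFusionCategory.simple_unit
  let A := (Functor.Monoidal.μIso F.obj.functor f f).symm ≪≫ (u₀ ⊗ᵢ u₀) ≪≫ e₀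
  let B := F.obj.functor.mapIso e₀ ≪≫ (Functor.Monoidal.εIso F.obj.functor).symm
  obtain ⟨c, hc⟩ := exists_smul_eq h1 B A
  have hc0 : c ≠ 0 := by
    rintro rfl
    rw [zero_smul] at hc
    apply id_nonzero (𝟙_ C)
    rw [← B.inv_hom_id, hc, Limits.comp_zero]
  obtain ⟨w, hw⟩ := IsAlgClosed.exists_pow_nat_eq c (n := 2) two_pos
  have hw0 : w ≠ 0 := by
    rintro rfl
    exact hc0 (by rw [← hw]; simp)
  have hAB : δ F.obj.functor f f ≫ ((w • u₀.hom) ⊗ₘ (w • u₀.hom)) ≫ e₀.hom =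
      F.obj.functor.map e₀.hom ≫ η F.obj.functor := by
    have hB : F.obj.functor.map e₀.hom ≫ η F.obj.functor =
      c • (δ F.obj.functor f f ≫ (u₀.hom ⊗ₘ u₀.hom) ≫ e₀.hom) := hc
    rw [hB, ← hw]
    simp [MonoidalCategory.tensorHom_def, smul_smul, sq]
  refine ⟨{ hom := w • u₀.hom, inv := w⁻¹ • u₀.inv,
            hom_inv_id := by simp [smul_smul, hw0],
            inv_hom_id := by simp [smul_smul, hw0] }, fun e => ?_⟩
  obtain ⟨k, hk⟩ := exists_smul_id h1 (e₀.inv ≫ e)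
  have he : e = k • e₀.hom := by
    rw [← cancel_epi e₀.inv, hk]
    simp
  rw [he, Linear.comp_smul, Linear.comp_smul, hAB, Functor.map_smul, Linear.smul_comp]

theorem sq_eq_one_of_trivialization (hf : IsFermion σ) {F : C ⥤ C} [F.Monoidal]
    {u v : F.obj f ≅ f} (hu : IsTensorTrivialization F u) (hv : IsTensorTrivialization F v)
    {s : ℂ} (hs : u.hom = s • v.hom) : s = 1 ∨ s = -1 := by
  obtain ⟨e₀⟩ := hf.sq_iso_unit
  have h1 : Simple (𝟙_ C) := IsFusionCategory.simple_unit
  have h := hu e₀.hom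
  rw [← hv e₀.hom, hs] at h
  have h2 : (s * s) • ((Functor.Monoidal.μIso F f f).symm ≪≫ (v ⊗ᵢ v) ≪≫ e₀).hom =
      (1 : ℂ) • ((Functor.Monoidal.μIso F f f).symm ≪≫ (v ⊗ᵢ v) ≪≫ e₀).hom := by
    rw [one_smul]
    refine Eq.trans ?_ h
    simp [MonoidalCategory.tensorHom_def, smul_smul]
  exact mul_self_eq_one_iff.1 (smul_hom_injective h1 _ h2)

end IsFermion

/-- The composite `(gh)_* f → g_* h_* f → g_* f → f`. -/
noncomputable def compositeIso (L : Discrete G ⥤ FermAut σ) [L.Monoidal]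
    (u : ∀ g, (act L g).obj f ≅ f) (g h : G) : (act L (g * h)).obj f ≅ f :=
  (TensorAut.Hom.iso ((isFermionic σ).ι.map (δ L ⟨g⟩ ⟨h⟩))).app f ≪≫
    (act L g).mapIso (u h) ≪≫ u g

theorem IsFermion.nonempty_restrictionCochain (hf : IsFermion σ) (L : Discrete G ⥤ FermAut σ)
    [L.Monoidal] : Nonempty (RestrictionCochain L) := by
  choose u hu using fun g : G => hf.exists_trivialization (L.obj ⟨g⟩)
  have h (g h : G) : ∃ c : ZMod 2, (u (g * h)).hom =
      (-1 : ℂ) ^ c.val • (actSplit L g h f ≫ (act L g).map (u h).hom ≫ (u g).hom) := by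
    have hv : IsTensorTrivialization (act L (g * h)) (compositeIso L u g h) :=
      IsTensorTrivialization.of_nat (F := (L.obj ⟨g * h⟩).obj)
        (H := (L.obj ⟨g⟩).obj ⊗ (L.obj ⟨h⟩).obj) (δ L ⟨g⟩ ⟨h⟩).hom
        (u := (act L g).mapIso (u h) ≪≫ u g)
        (IsTensorTrivialization.comp (hu g) (hu h)) rfl
    obtain ⟨s, hs⟩ := exists_smul_eq hf.simple (u (g * h)) (compositeIso L u g h)
    rcases hf.sq_eq_one_of_trivialization (hu (g * h)) hv hs with rfl | rfl
    · exact ⟨0, by simpa using! hs⟩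
    · exact ⟨1, by simpa [ZMod.val_one] using! hs⟩
  choose c hc using h
  exact ⟨⟨u, hu, fun p => c p.1 p.2, hc⟩⟩

theorem RestrictionCochain.transport {L : Discrete G ⥤ FermAut σ} [L.Monoidal]
    (T : RestrictionCochain L) {a b : Discrete G} (m : a ⟶ b) :
    TensorAut.app (L.map m).hom f ≫ (T.u b.as).hom = (T.u a.as).hom := by
  obtain ⟨a⟩ := a
  obtain ⟨b⟩ := b
  obtain rfl : a = b := Discrete.eq_of_hom m
  obtain rfl : m = 𝟙 _ := Subsingleton.elim _ _
  rw [L.map_id]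
  exact Category.id_comp _

theorem actSplit_coherence (L : Discrete G ⥤ FermAut σ) [L.Monoidal] (g h k : G) (X : C) :
    actSplit L (g * h) k X ≫ actSplit L g h ((act L k).obj X) =
      TensorAut.app (L.map (α_ (⟨g⟩ : Discrete G) ⟨h⟩ ⟨k⟩).hom).hom X ≫
        actSplit L g (h * k) X ≫ (act L g).map (actSplit L h k X) := by
  have h1 := congrArg (fun t => TensorAut.app (InducedCategory.Hom.hom t) X)
    (associativity L (⟨g⟩ : Discrete G) ⟨h⟩ ⟨k⟩)
  refine Eq.trans ?_ h1
  change _ = actSplit L (g * h) k X ≫ actSplit L g h ((act L k).obj X) ≫ 𝟙 _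
  rw [Category.comp_id]

theorem RestrictionCochain.mem_cocycles₂ (hf : IsFermion σ) {L : Discrete G ⥤ FermAut σ}
    [L.Monoidal] (T : RestrictionCochain L) : T.c ∈ groupCohomology.cocycles₂ (zmodTwoRep G) := by
  rw [groupCohomology.mem_cocycles₂_iff]
  intro g h k
  change T.c (g * h, k) + T.c (g, h) = T.c (h, k) + T.c (g, h * k)
  have hz (a : ZMod 2) : a = 0 ∨ a = 1 := by revert a; decide
  let s (a : ZMod 2) : ℂ := (-1) ^ a.val
  have hs (a b : ZMod 2) : s (a + b) = s a * s b := by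
    rcases hz a with rfl | rfl <;> rcases hz b with rfl | rfl <;>
      simp [s, ZMod.val_one, CharTwo.add_self_eq_zero]
  have hsinj (a b : ZMod 2) (hab : s a = s b) : a = b := by
    have hne : (1 : ℂ) ≠ -1 := by norm_num
    rcases hz a with rfl | rfl <;> rcases hz b with rfl | rfl <;>
      simp [s, ZMod.val_one, hne, hne.symm] at hab ⊢
  let W := TensorAut.app (L.map (α_ (⟨g⟩ : Discrete G) ⟨h⟩ ⟨k⟩).hom).hom f ≫
    actSplit L g (h * k) f ≫ (act L g).map (actSplit L h k f) ≫
      (act L g).map ((act L h).map (T.u k).hom) ≫ (act L g).map (T.u h).hom ≫ (T.u g).hom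
  have hW1 : (T.u (g * h * k)).hom = s (T.c (g * h, k) + T.c (g, h)) • W := by
    have nat : (act L (g * h)).map (T.u k).hom ≫ actSplit L g h f =
        actSplit L g h ((act L k).obj f) ≫ (act L g).map ((act L h).map (T.u k).hom) :=
      TensorAut.naturality (δ L ⟨g⟩ ⟨h⟩).hom (T.u k).hom
    rw [T.compare (g * h) k, T.compare g h, Linear.comp_smul, Linear.comp_smul, smul_smul, ← hs,
      reassoc_of% nat, reassoc_of% (actSplit_coherence L g h k f)]
  have hW2 : (T.u (g * h * k)).hom = s (T.c (h, k) + T.c (g, h * k)) • W := by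
    refine (T.transport (α_ (⟨g⟩ : Discrete G) ⟨h⟩ ⟨k⟩).hom).symm.trans ?_
    change _ ≫ (T.u (g * (h * k))).hom = _
    rw [T.compare g (h * k), T.compare h k, Functor.map_smul, Linear.smul_comp, Linear.comp_smul,
      Linear.comp_smul, Linear.comp_smul, smul_smul, ← hs, add_comm (T.c (h, k))]
    simp only [Functor.map_comp, Category.assoc, W]
  apply hsinj
  have hsq (a : ZMod 2) : s a * s a = 1 := by rw [← hs, CharTwo.add_self_eq_zero]; simp [s]
  apply smul_hom_injective hf.simple (T.u (g * h * k))
  conv_lhs => rw [hW1]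
  conv_rhs => rw [hW2]
  rw [smul_smul, smul_smul, hsq, hsq]

/-- The class `θ` in `H²(G, ℤ/2ℤ)` that corresponds to the restriction to `⟨f⟩` of an action of `G`
on `C` by fermionic tensor autoequivalences. -/
noncomputable def IsFermion.theta (hf : IsFermion σ) (L : Discrete G ⥤ FermAut σ) [L.Monoidal] :
    groupCohomology (zmodTwoRep G) 2 :=
  groupCohomology.H2π (zmodTwoRep G)
    ⟨(hf.nonempty_restrictionCochain L).some.c,
      (hf.nonempty_restrictionCochain L).some.mem_cocycles₂ hf⟩

end Actions

section Liftings

variable {C : Type u} [Category.{v} C] [Abelian C] [Linear ℂ C] [MonoidalCategory C]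
  [MonoidalPreadditive C] [MonoidalLinear ℂ C] [IsFusionCategory C]
  {f : C} {σ : HalfBraiding f} {G : Type} [Group G]

/-- A (bosonic) lifting of `ρ : G → Aut_⊗(C, f)`: a monoidal functor from the discrete monoidal
category `G` to the monoidal category `Aut_⊗(C, f)`, such that the isomorphism class of the image
of `g` is `ρ g`. -/
structure Lifting (ρ : G →* FermAutClasses σ) where
  functor : Discrete G ⥤ FermAut σ
  [monoidal : functor.Monoidal]
  lifts : ∀ g, toSkeleton (functor.obj ⟨g⟩) = ρ g

attribute [instance] Lifting.monoidal

/-- Equivalence of liftings: isomorphism of monoidal functors. -/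
def Lifting.Equivalent {ρ : G →* FermAutClasses σ} (L M : Lifting ρ) : Prop :=
  ∃ e : L.functor ≅ M.functor, NatTrans.IsMonoidal e.hom

/-- An `α`-lifting of `ρ`: a lifting which is a fermionic action of `(G, α)`, i.e. whose restriction
to `⟨f⟩` corresponds to `α`. -/
def AlphaLifting (hf : IsFermion σ) (ρ : G →* FermAutClasses σ)
    (α : groupCohomology (zmodTwoRep G) 2) :=
  {L : Lifting ρ // hf.theta L.functor = α}

/-- The setoid of equivalence of `α`-liftings. -/
def alphaLiftingSetoid (hf : IsFermion σ) (ρ : G →* FermAutClasses σ)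
    (α : groupCohomology (zmodTwoRep G) 2) : Setoid (AlphaLifting hf ρ α) where
  r L M := L.1.Equivalent M.1
  iseqv :=
    { refl := fun L => ⟨Iso.refl _, inferInstanceAs (NatTrans.IsMonoidal (𝟙 L.1.functor))⟩
      symm := fun ⟨e, _⟩ => ⟨e.symm, inferInstanceAs (NatTrans.IsMonoidal e.inv)⟩
      trans := fun ⟨e, _⟩ ⟨e', _⟩ =>
        ⟨e ≪≫ e', inferInstanceAs (NatTrans.IsMonoidal (e.hom ≫ e'.hom))⟩ }

/-- The set of equivalence classes of `α`-liftings of `ρ`. -/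
abbrev AlphaLiftingClasses (hf : IsFermion σ) (ρ : G →* FermAutClasses σ)
    (α : groupCohomology (zmodTwoRep G) 2) :=
  Quotient (alphaLiftingSetoid hf ρ α)

/-- The value `χ(X)` of a character at a simple object. -/
noncomputable def charEval {ρ : G →* FermAutClasses σ} (χ : charRep ρ) (X : C) (hX : Simple X) :
    ℂ :=
  (Additive.toMul (α := K0hat C) χ).1 (Irr.mk X hX)

/-- `M` is equivalent to `β ▷ L`, the twist of the lifting `L` by `β`: there are a cocycle `b`
representing `β` and tensor isomorphisms `ψ_g : g_*^L ≅ g_*^M` that carry `b(g,h) φ^L(g,h)` to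
`φ^M(g,h)`. Here a character `χ` acts on a tensor functor `F` as the tensor automorphism which is
multiplication by `χ(F X)` on `F X` for simple `X`. Tensor isomorphisms between additive functors
are determined by their components at simple objects. -/
def IsTwist {ρ : G →* FermAutClasses σ} (β : groupCohomology (charRep ρ) 2) (L M : Lifting ρ) :
    Prop :=
  ∃ (b : groupCohomology.cocycles₂ (charRep ρ)) (ψ : ∀ g, L.functor.obj ⟨g⟩ ≅ M.functor.obj ⟨g⟩),
    groupCohomology.H2π (charRep ρ) b = β ∧
    ∀ (g h : G) (X : C) (hX : Simple X),
      TensorAut.app (ψ (g * h)).hom.hom X ≫ actSplit M.functor g h X =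
        charEval (b (g, h)) ((act L.functor (g * h)).obj X)
            (simple_functor_obj (L.functor.obj ⟨g * h⟩).obj hX) •
          (actSplit L.functor g h X ≫ TensorAut.app ((ψ g).hom ⊗ₘ (ψ h).hom).hom X)

open Classical in
/-- The obstruction `O₃(L, α)` of a lifting `L` (written additively): the class `θ_L - α` in
`H²(G, ℤ/2ℤ)` if `r` is trivial, and `d₂(θ_L - α)` in `H³(G, Ker r)` if `r` is nontrivial. -/
noncomputable def obstruction (hf : IsFermion σ) {ρ : G →* FermAutClasses σ} (L : Lifting ρ)
    (α : groupCohomology (zmodTwoRep G) 2) :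
    groupCohomology (zmodTwoRep G) 2 ⊕ groupCohomology (Limits.kernel (hf.restrict ρ)) 3 :=
  if h : hf.RestrictTrivial then Sum.inl (hf.theta L.functor - α)
  else Sum.inr (hf.connecting ρ h (hf.theta L.functor - α))

/-- An obstruction vanishes if it is zero in the cohomology group that it lies in. -/
def ObstructionVanishes {A B : Type} [Zero A] [Zero B] (x : A ⊕ B) : Prop :=
  x = Sum.inl 0 ∨ x = Sum.inr 0

end Liftings

end Fermionic

open Fermionic

/-!
Let `charTwist χ F` be the tensor endomorphism of a tensor autoequivalence `F` which is
multiplication by `χ(F X)` on `F X` for simple `X`; it exists for every character `χ` of `K₀(C)`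
because `C` is semisimple and `χ` is multiplicative on constituents of tensor products
(`charScale_naturality`, `charScale_tensor`).
These endomorphisms are natural in `F`, whiskering on the right by a functor leaves `χ` unchanged,
and whiskering on the left by a functor in the class `ρ g` replaces `χ` by `g χ`
(`whiskerLeft_charTwist`). Conversely, by Schur's lemma every tensor endomorphism of `F` arises from
exactly one character (`exists_charTwist_eq`, `charTwist_injective`).

Any two liftings `L`, `M` of `ρ` have isomorphic functors `g_*`, and for a choice of isomorphisms
the tensor isomorphisms `φ(g,h)` of `L` and `M` differ by unique characters `b(g,h)`. Associativity
of `L` and `M` says that `b` is a `2`-cocycle (`IsTwistedIso.mem_cocycles₂`), other isomorphisms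
change it by a coboundary (`IsTwistedIso.rescale`), every cocycle occurs (`Lifting.twist`), and the
cocycle can be made to vanish exactly if `L` and `M` are equivalent (`IsTwist.zero_iff`). So the
classes of liftings form a torsor over `H²(G, K₀(C)^)`.

A trivialization on `⟨f⟩` can be carried along such isomorphisms, and the character `b(g,h)` then
contributes the sign `b(g,h)(f)`. Hence `θ` changes by `r_* β` under the twist by `β`
(`IsTwist.theta_eq`), so that the `α`-liftings form a torsor over `Ker r_*`, and one exists if and
only if `θ_L - α` lies in the image of `r_*`. By exactness of the long cohomology sequence at
`H²(G, ℤ/2ℤ)` this image is the kernel of `d₂` if `r` is nontrivial, while it is zero if `r` is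
trivial; in both cases the image is what the obstruction does not see.
-/

namespace Fermionic

/-! ### Characters as tensor automorphisms of the identity functor -/

section Scaling

variable {C : Type u} [Category.{v} C] [Abelian C] [Linear ℂ C] [MonoidalCategory C]
  [MonoidalPreadditive C] [MonoidalLinear ℂ C] [IsFusionCategory C]

variable (C) in
theorem IsFusionCategory.exists_sum_eq_id (X : C) :
    ∃ (n : ℕ) (S : Fin n → C) (_ : ∀ i, Simple (S i)) (p : ∀ i, X ⟶ S i) (j : ∀ i, S i ⟶ X),
      ∑ i, p i ≫ j i = 𝟙 X := by
  obtain ⟨n, S, hS, b, ⟨e⟩, ⟨hb⟩⟩ := IsFusionCategory.semisimple X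
  refine ⟨n, S, hS, fun i => e.inv ≫ b.π i, fun i => b.ι i ≫ e.hom, ?_⟩
  have h := Limits.IsBilimit.total hb
  calc ∑ i, (e.inv ≫ b.π i) ≫ b.ι i ≫ e.hom
      = e.inv ≫ (∑ i, b.π i ≫ b.ι i) ≫ e.hom := by
        simp [Preadditive.sum_comp, Preadditive.comp_sum]
    _ = 𝟙 X := by rw [h]; simp

/-- By semisimplicity, morphisms are determined by their composites with the morphisms from simple
objects to the source. -/
theorem hom_ext_of_simple {X Y : C} {s t : X ⟶ Y}
    (h : ∀ (S : C) (_ : Simple S) (j : S ⟶ X), j ≫ s = j ≫ t) : s = t := by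
  obtain ⟨n, S, hS, p, j, hpj⟩ := IsFusionCategory.exists_sum_eq_id C X
  rw [← Category.id_comp s, ← Category.id_comp t, ← hpj, Preadditive.sum_comp,
    Preadditive.sum_comp]
  exact Finset.sum_congr rfl fun i _ => by rw [Category.assoc, Category.assoc, h _ (hS i)]

theorem Irr.mk_eq_of_ne_zero {S T : C} (hS : Simple S) (hT : Simple T) {q : S ⟶ T} (hq : q ≠ 0) :
    Irr.mk S hS = Irr.mk T hT := by
  have := isIso_of_hom_simple hq
  exact (Irr.mk_eq_mk hS hT).2 ⟨asIso q⟩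

theorem exists_charScale (χ : K0hat C) (X : C) : ∃ t : X ⟶ X,
    ∀ (S : C) (hS : Simple S) (j : S ⟶ X), j ≫ t = (χ.1 (Irr.mk S hS) : ℂ) • j := by
  obtain ⟨n, S, hS, p, j, hpj⟩ := IsFusionCategory.exists_sum_eq_id C X
  refine ⟨∑ i, (χ.1 (Irr.mk (S i) (hS i)) : ℂ) • (p i ≫ j i), fun T hT q => ?_⟩
  conv_rhs => rw [← Category.comp_id q, ← hpj, Preadditive.comp_sum, Finset.smul_sum]
  rw [Preadditive.comp_sum]
  refine Finset.sum_congr rfl fun i _ => ?_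
  rw [Linear.comp_smul]
  by_cases hq : q ≫ p i = 0
  · rw [reassoc_of% hq, Limits.zero_comp, smul_zero, smul_zero]
  · rw [Irr.mk_eq_of_ne_zero hT (hS i) hq]

/-- The endomorphism of `X` that acts on every simple subobject `S` of `X` as multiplication by
`χ(S)`. For varying `X` this is the tensor automorphism of the identity functor of `C` which
corresponds to the character `χ`. -/
noncomputable def charScale (χ : K0hat C) (X : C) : X ⟶ X := (exists_charScale χ X).choose

theorem comp_charScale (χ : K0hat C) {S X : C} (hS : Simple S) (j : S ⟶ X) :
    j ≫ charScale χ X = (χ.1 (Irr.mk S hS) : ℂ) • j :=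
  (exists_charScale χ X).choose_spec S hS j

theorem charScale_simple (χ : K0hat C) {X : C} (hX : Simple X) :
    charScale χ X = (χ.1 (Irr.mk X hX) : ℂ) • 𝟙 X := by
  rw [← comp_charScale χ hX, Category.id_comp]

theorem charScale_naturality (χ : K0hat C) {X Y : C} (q : X ⟶ Y) :
    q ≫ charScale χ Y = charScale χ X ≫ q := by
  refine hom_ext_of_simple fun S hS j => ?_
  rw [← Category.assoc, comp_charScale χ hS, ← Category.assoc, comp_charScale χ hS,
    Linear.smul_comp]

@[simp]
theorem charScale_one (X : C) : charScale (1 : K0hat C) X = 𝟙 X := by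
  refine hom_ext_of_simple fun S hS j => ?_
  rw [comp_charScale _ hS, Category.comp_id]
  exact one_smul _ _

theorem charScale_mul (χ ψ : K0hat C) (X : C) :
    charScale (χ * ψ) X = charScale χ X ≫ charScale ψ X := by
  refine hom_ext_of_simple fun S hS j => ?_
  rw [comp_charScale _ hS, ← Category.assoc, comp_charScale χ hS, Linear.smul_comp,
    comp_charScale ψ hS, smul_smul]
  rfl

theorem K0hat.apply_unit (χ : K0hat C) (h1 : Simple (𝟙_ C)) : χ.1 (Irr.mk (𝟙_ C) h1) = 1 := by
  have h := χ.2 (𝟙_ C) (𝟙_ C) (𝟙_ C) h1 h1 h1 ⟨(λ_ (𝟙_ C)).inv, fun h0 => id_nonzero (𝟙_ C) (by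
    rw [← (λ_ (𝟙_ C)).inv_hom_id, h0, Limits.zero_comp])⟩
  exact mul_eq_left.1 h.symm

theorem charScale_unit (χ : K0hat C) : charScale χ (𝟙_ C) = 𝟙 (𝟙_ C) := by
  have h1 : Simple (𝟙_ C) := IsFusionCategory.simple_unit
  rw [charScale_simple χ h1, K0hat.apply_unit χ h1]
  exact one_smul _ _

/-- Multiplicativity of `χ` on constituents of tensor products, extended from simple objects to all
objects by additivity. -/
theorem charScale_tensor (χ : K0hat C) (X Y : C) :
    charScale χ (X ⊗ Y) = charScale χ X ⊗ₘ charScale χ Y := by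
  obtain ⟨n, S, hS, p, j, hpj⟩ := IsFusionCategory.exists_sum_eq_id C X
  obtain ⟨m, T, hT, q, k, hqk⟩ := IsFusionCategory.exists_sum_eq_id C Y
  have key (a : Fin n) (b : Fin m) :
      (j a ⊗ₘ k b) ≫ charScale χ (X ⊗ Y) = (j a ⊗ₘ k b) ≫ (charScale χ X ⊗ₘ charScale χ Y) := by
    rw [charScale_naturality, tensorHom_comp_tensorHom, comp_charScale χ (hS a),
      comp_charScale χ (hT b)]
    refine hom_ext_of_simple fun Z hZ i => ?_
    rw [← Category.assoc, comp_charScale χ hZ]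
    by_cases hi : i = 0
    · simp [hi]
    · rw [χ.2 _ _ Z (hS a) (hT b) hZ ⟨i, hi⟩]
      simp [MonoidalCategory.tensorHom_def, smul_smul, mul_comm]
  have hid : 𝟙 (X ⊗ Y) = ∑ a, ∑ b, (p a ⊗ₘ q b) ≫ (j a ⊗ₘ k b) := by
    simp only [tensorHom_comp_tensorHom, ← tensor_sum, ← sum_tensor, hpj, hqk, id_tensorHom_id]
  rw [← Category.id_comp (charScale χ (X ⊗ Y)), ← Category.id_comp (charScale χ X ⊗ₘ _), hid]
  simp only [Preadditive.sum_comp, Category.assoc, key]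

/-- Tensor autoequivalences turn the scaling by the pullback of a character into the scaling by the
character itself. -/
theorem map_charScale_pullback (F : TensorAut C) (χ : K0hat C) (X : C) :
    F.functor.map (charScale (K0hat.pullback F χ) X) = charScale χ (F.functor.obj X) := by
  obtain ⟨n, S, hS, p, j, hpj⟩ := IsFusionCategory.exists_sum_eq_id C X
  have key (a : Fin n) : F.functor.map (j a) ≫ F.functor.map (charScale (K0hat.pullback F χ) X) =
      F.functor.map (j a) ≫ charScale χ (F.functor.obj X) := by
    rw [← F.functor.map_comp, comp_charScale _ (hS a),
      comp_charScale _ (simple_functor_obj F (hS a)), Functor.map_smul, ← irrMap_mk]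
    rfl
  rw [← Category.id_comp (F.functor.map _), ← Category.id_comp (charScale χ _),
    ← F.functor.map_id, ← hpj, Functor.map_sum, Preadditive.sum_comp, Preadditive.sum_comp]
  simp only [Functor.map_comp, Category.assoc, key]

end Scaling

/-! ### Tensor endomorphisms of fermionic tensor autoequivalences -/

section CharTwist

open Functor.OplaxMonoidal Functor.LaxMonoidal

variable {C : Type u} [Category.{v} C] [Abelian C] [Linear ℂ C] [MonoidalCategory C]
  [MonoidalPreadditive C] [MonoidalLinear ℂ C] [IsFusionCategory C]
  {f : C} {σ : HalfBraiding f} {G : Type} [Group G] {ρ : G →* FermAutClasses σ}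

/-- The tensor endomorphism of a fermionic tensor autoequivalence `F` which is multiplication by
`χ(F X)` on `F X` for simple `X`. -/
noncomputable def charTwist (χ : charRep ρ) (F : FermAut σ) : F ⟶ F :=
  ObjectProperty.homMk
    (TensorAut.Hom.mk (F := F.obj) (G := F.obj)
      { hom :=
          { app X := charScale (Additive.toMul (α := K0hat C) χ) (F.obj.functor.obj X)
            naturality _ _ q := charScale_naturality _ (F.obj.functor.map q) }
        inv :=
          { app X := charScale (Additive.toMul (α := K0hat C) χ)⁻¹ (F.obj.functor.obj X)
            naturality _ _ q := charScale_naturality _ (F.obj.functor.map q) }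
        hom_inv_id := by
          ext X
          simp [← charScale_mul]
        inv_hom_id := by
          ext X
          simp [← charScale_mul] }
      (isMonoidal :=
        { unit := by
            change ε F.obj.functor ≫ charScale _ _ = _
            rw [charScale_naturality, charScale_unit, Category.id_comp]
          tensor X Y := by
            change μ F.obj.functor X Y ≫ charScale _ _ = (charScale _ _ ⊗ₘ charScale _ _) ≫ _
            rw [charScale_naturality, charScale_tensor] }))

theorem charTwist_app (χ : charRep ρ) (F : FermAut σ) (X : C) :
    TensorAut.app (charTwist χ F).hom X =
      charScale (Additive.toMul (α := K0hat C) χ) (F.obj.functor.obj X) := rfl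

theorem FermAut.hom_ext {F H : FermAut σ} {s t : F ⟶ H}
    (h : ∀ X, TensorAut.app s.hom X = TensorAut.app t.hom X) : s = t :=
  ObjectProperty.hom_ext _ (TensorAut.hom_ext h)

@[simp]
theorem charTwist_zero (F : FermAut σ) : charTwist (0 : charRep ρ) F = 𝟙 F :=
  FermAut.hom_ext fun X => charScale_one (F.obj.functor.obj X)

theorem charTwist_add (χ ψ : charRep ρ) (F : FermAut σ) :
    charTwist (χ + ψ) F = charTwist χ F ≫ charTwist ψ F :=
  FermAut.hom_ext fun X => charScale_mul _ _ (F.obj.functor.obj X)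

theorem charTwist_comp_charTwist (χ ψ : charRep ρ) {F H : FermAut σ} (t : F ⟶ H) :
    charTwist χ F ≫ charTwist ψ F ≫ t = charTwist (χ + ψ) F ≫ t := by
  rw [charTwist_add, Category.assoc]

theorem charTwist_naturality (χ : charRep ρ) {F H : FermAut σ} (t : F ⟶ H) :
    t ≫ charTwist χ H = charTwist χ F ≫ t :=
  FermAut.hom_ext fun X => charScale_naturality _ (TensorAut.app t.hom X)

theorem charTwist_whiskerRight (χ : charRep ρ) (F H : FermAut σ) :
    charTwist χ F ▷ H = charTwist χ (F ⊗ H) := rfl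

/-- Pullback along a functor in the class `ρ g` inverts the action of `g` on characters. -/
theorem pullback_charRep (g : G) (χ : charRep ρ) {F : FermAut σ} (hF : toSkeleton F = ρ g) :
    K0hat.pullback F.obj (Additive.toMul (α := K0hat C) ((charRep ρ).ρ g χ)) =
      Additive.toMul (α := K0hat C) χ := by
  change K0hat.pullback F.obj (K0hat.pullback (ρ g⁻¹).rep (Additive.toMul (α := K0hat C) χ)) = _
  rw [← K0hat.pullback_congr (FermAutClasses.rep_iso hF), ← K0hat.pullback_tensor,
    ← K0hat.pullback_congr (FermAutClasses.rep_mul _ _), ← map_mul, inv_mul_cancel, map_one,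
    K0hat.pullback_congr FermAutClasses.rep_one, K0hat.pullback_unit]

/-- Left whiskering with a functor in the class `ρ g` realizes the action of `g` on characters. -/
theorem whiskerLeft_charTwist (g : G) (χ : charRep ρ) {F : FermAut σ} (hF : toSkeleton F = ρ g)
    (H : FermAut σ) : F ◁ charTwist χ H = charTwist ((charRep ρ).ρ g χ) (F ⊗ H) := by
  refine FermAut.hom_ext fun X => ?_
  change F.obj.functor.map (charScale _ _) = charScale _ (F.obj.functor.obj _)
  rw [← pullback_charRep g χ hF]
  exact map_charScale_pullback F.obj _ _

theorem TensorAut.hom_ext_of_simple {F H : TensorAut C} {s t : F ⟶ H}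
    (h : ∀ (X : C) (_ : Simple X), TensorAut.app s X = TensorAut.app t X) : s = t := by
  refine TensorAut.hom_ext fun X => ?_
  obtain ⟨n, S, hS, p, j, hpj⟩ := IsFusionCategory.exists_sum_eq_id C X
  rw [← Category.id_comp (TensorAut.app s X), ← Category.id_comp (TensorAut.app t X),
    ← F.functor.map_id, ← hpj, Functor.map_sum, Preadditive.sum_comp, Preadditive.sum_comp]
  refine Finset.sum_congr rfl fun i _ => ?_
  rw [F.functor.map_comp, Category.assoc, Category.assoc, TensorAut.naturality,
    TensorAut.naturality, h _ (hS i)]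

theorem charTwist_injective (g : G) {F : FermAut σ} (hF : toSkeleton F = ρ g) {χ ψ : charRep ρ}
    (h : charTwist χ F = charTwist ψ F) : χ = ψ := by
  have key (θ : charRep ρ) : K0hat.pullback F.obj (Additive.toMul (α := K0hat C) θ) =
      Additive.toMul (α := K0hat C) ((charRep ρ).ρ g⁻¹ θ) := by
    have h1 := pullback_charRep g ((charRep ρ).ρ g⁻¹ θ) hF
    rwa [Representation.self_inv_apply] at h1
  have h2 : K0hat.pullback F.obj (Additive.toMul (α := K0hat C) χ) =
      K0hat.pullback F.obj (Additive.toMul (α := K0hat C) ψ) := by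
    apply Subtype.ext
    funext i
    induction i using Irr.ind with
    | h X hX =>
      have h3 := congrArg (fun t => TensorAut.app (InducedCategory.Hom.hom t) X) h
      have hFX := simple_functor_obj F.obj hX
      change charScale (Additive.toMul (α := K0hat C) χ) (F.obj.functor.obj X) =
        charScale (Additive.toMul (α := K0hat C) ψ) (F.obj.functor.obj X) at h3
      rw [charScale_simple _ hFX, charScale_simple _ hFX] at h3
      have h4 := smul_hom_injective hFX (Iso.refl _) h3
      change (Additive.toMul (α := K0hat C) χ).1 (irrMap F.obj _) =
        (Additive.toMul (α := K0hat C) ψ).1 (irrMap F.obj _)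
      rw [irrMap_mk]
      exact Units.ext h4
  rw [key, key] at h2
  have h5 := congrArg ((charRep ρ).ρ g) (Additive.toMul.injective h2)
  rwa [Representation.self_inv_apply, Representation.self_inv_apply] at h5

/-- The scalars by which a tensor automorphism acts on the images of the simple objects form a
character: this is compatibility with the tensor product, read off on a constituent `Z` of
`X ⊗ Y`. -/
theorem exists_character_of_end {F : TensorAut C} (s : F ⟶ F) : ∃ χ : K0hat C,
    ∀ (X : C) (hX : Simple X),
      TensorAut.app s X = (χ.1 (Irr.mk X hX) : ℂ) • 𝟙 (F.functor.obj X) := by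
  have hex (i : Irr C) : ∃ c : ℂˣ, ∀ (X : C) (hX : Simple X), Irr.mk X hX = i →
      TensorAut.app s X = (c : ℂ) • 𝟙 (F.functor.obj X) := by
    induction i using Irr.ind with
    | h Y hY =>
      have hFY := simple_functor_obj F hY
      obtain ⟨c, hc⟩ := exists_smul_id hFY (TensorAut.app s Y)
      have hc0 : c ≠ 0 := by
        rintro rfl
        apply id_nonzero (F.functor.obj Y)
        have h1 : TensorAut.app s Y ≫ (TensorAut.Hom.iso s).inv.app Y = 𝟙 _ :=
          (TensorAut.Hom.iso s).hom_inv_id_app Y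
        rw [← h1, hc, zero_smul, Limits.zero_comp]
      refine ⟨Units.mk0 c hc0, fun X hX h => ?_⟩
      obtain ⟨e⟩ := (Irr.mk_eq_mk hX hY).1 h
      have h2 := TensorAut.naturality s e.hom
      rw [hc, Linear.comp_smul, Category.comp_id] at h2
      rw [← cancel_mono (F.functor.map e.hom), ← h2]
      simp
  choose c hc using hex
  have hval (X : C) (hX : Simple X) := hc _ X hX rfl
  refine ⟨⟨c, fun X Y Z hX hY hZ ⟨i, hi⟩ => ?_⟩, hval⟩
  have hten := NatTrans.IsMonoidal.tensor (τ := (TensorAut.Hom.iso s).hom) X Y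
  change μ F.functor X Y ≫ TensorAut.app s (X ⊗ Y) =
    (TensorAut.app s X ⊗ₘ TensorAut.app s Y) ≫ μ F.functor X Y at hten
  have hXY : TensorAut.app s (X ⊗ Y) =
      ((c (Irr.mk X hX) : ℂ) * c (Irr.mk Y hY)) • 𝟙 (F.functor.obj (X ⊗ Y)) := by
    rw [← cancel_epi (μ F.functor X Y), hten, hval X hX, hval Y hY]
    simp [MonoidalCategory.tensorHom_def, smul_smul, mul_comm]
  have hnat := TensorAut.naturality s i
  rw [hXY, hval Z hZ] at hnat
  simp only [Linear.comp_smul, Linear.smul_comp, Category.comp_id, Category.id_comp] at hnat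
  rw [← sub_eq_zero, ← sub_smul, smul_eq_zero] at hnat
  rcases hnat with h | h
  · exact Units.ext (by rw [Units.val_mul]; exact (sub_eq_zero.1 h).symm)
  · exact absurd (F.functor.map_eq_zero_iff.1 h) hi

/-- Every tensor endomorphism of a tensor autoequivalence in the class `ρ g` is the twist by a
character. -/
theorem exists_charTwist_eq (g : G) {F : FermAut σ} (hF : toSkeleton F = ρ g) (s : F ⟶ F) :
    ∃ χ : charRep ρ, charTwist χ F = s := by
  obtain ⟨ψ, hψ⟩ := exists_character_of_end s.hom
  let χ : charRep ρ := (Additive.ofMul ψ : Additive (K0hat C))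
  have hχ : K0hat.pullback F.obj (Additive.toMul (α := K0hat C) ((charRep ρ).ρ g χ)) = ψ :=
    pullback_charRep g χ hF
  refine ⟨(charRep ρ).ρ g χ, ObjectProperty.hom_ext _
    (TensorAut.hom_ext_of_simple fun X hX => ?_)⟩
  rw [hψ X hX]
  change charScale _ (F.obj.functor.obj X) = _
  rw [← map_charScale_pullback, hχ, charScale_simple ψ hX, Functor.map_smul,
    CategoryTheory.Functor.map_id]

end CharTwist

/-! ### Twisted isomorphisms of liftings -/

section MonoidalIso

open Functor.OplaxMonoidal Functor.LaxMonoidal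

variable {D : Type*} [Category* D] [MonoidalCategory D] {E : Type*} [Category* E]
  [MonoidalCategory E]

/-- For strong monoidal functors, compatibility of a natural isomorphism with the tensor products
implies its compatibility with the units. -/
theorem isMonoidal_of_tensor {F H : D ⥤ E} [F.Monoidal] [H.Monoidal] (e : F ≅ H)
    (h : ∀ X Y, e.hom.app (X ⊗ Y) ≫ δ H X Y = δ F X Y ≫ (e.hom.app X ⊗ₘ e.hom.app Y)) :
    NatTrans.IsMonoidal e.hom := by
  have hten (X Y : D) : μ F X Y ≫ e.hom.app (X ⊗ Y) = (e.hom.app X ⊗ₘ e.hom.app Y) ≫ μ H X Y := by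
    rw [← cancel_mono (δ H X Y), Category.assoc, h, Functor.Monoidal.μ_δ_assoc, Category.assoc,
      Functor.Monoidal.μ_δ, Category.comp_id]
  refine ⟨?_, hten⟩
  -- Left unitality shows compatibility with the unit after tensoring with `H 𝟙`, which is
  -- isomorphic to the unit.
  have h1 : (ε F ≫ e.hom.app (𝟙_ D)) ▷ H.obj (𝟙_ D) = ε H ▷ H.obj (𝟙_ D) := by
    have hL : (𝟙_ E ◁ e.hom.app (𝟙_ D)) ≫ (ε F ≫ e.hom.app (𝟙_ D)) ▷ H.obj (𝟙_ D) =
        ε F ▷ F.obj (𝟙_ D) ≫ (e.hom.app (𝟙_ D) ⊗ₘ e.hom.app (𝟙_ D)) := by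
      rw [whisker_exchange, comp_whiskerRight, MonoidalCategory.tensorHom_def, Category.assoc]
    rw [← cancel_epi (𝟙_ E ◁ e.hom.app (𝟙_ D)), ← cancel_mono (μ H (𝟙_ D) (𝟙_ D)), hL,
      ← cancel_epi (λ_ (F.obj (𝟙_ D))).inv, Category.assoc, Category.assoc, ← hten,
      left_unitality_inv_assoc, ← leftUnitor_inv_naturality_assoc, left_unitality_inv,
      e.hom.naturality]
  have h2 : (ε F ≫ e.hom.app (𝟙_ D)) ▷ 𝟙_ E = ε H ▷ 𝟙_ E := by
    rw [← cancel_mono (H.obj (𝟙_ D) ◁ ε H), ← whisker_exchange, h1, whisker_exchange]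
  exact (MonoidalCategory.whiskerRight_iff _ _).1 h2

theorem tensor_of_isMonoidal {F H : D ⥤ E} [F.Monoidal] [H.Monoidal] (t : F ⟶ H)
    [NatTrans.IsMonoidal t] (X Y : D) :
    t.app (X ⊗ Y) ≫ δ H X Y = δ F X Y ≫ (t.app X ⊗ₘ t.app Y) := by
  rw [← cancel_mono (μ H X Y), Category.assoc, Functor.Monoidal.δ_μ, Category.comp_id,
    Category.assoc, ← NatTrans.IsMonoidal.tensor, Functor.Monoidal.δ_μ_assoc]

end MonoidalIso

section TwistedIso

open Functor.OplaxMonoidal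

variable {C : Type u} [Category.{v} C] [Abelian C] [Linear ℂ C] [MonoidalCategory C]
  [MonoidalPreadditive C] [MonoidalLinear ℂ C] [IsFusionCategory C]
  {f : C} {σ : HalfBraiding f} {G : Type} [Group G] {ρ : G →* FermAutClasses σ}

theorem charTwist_comm (χ : charRep ρ) {F H : FermAut σ} (t : F ⟶ H) {K : FermAut σ} (s : H ⟶ K) :
    t ≫ charTwist χ H ≫ s = charTwist χ F ≫ t ≫ s := by
  rw [← Category.assoc, charTwist_naturality, Category.assoc]

theorem Lifting.toSkeleton_obj (L : Lifting ρ) (X : Discrete G) :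
    toSkeleton (L.functor.obj X) = ρ X.as := L.lifts X.as

theorem Lifting.charTwist_tensor (L : Lifting ρ) (χ ψ : charRep ρ) (X Y : Discrete G) :
    charTwist χ (L.functor.obj X) ⊗ₘ charTwist ψ (L.functor.obj Y) =
      charTwist (χ + (charRep ρ).ρ X.as ψ) (L.functor.obj X ⊗ L.functor.obj Y) := by
  rw [MonoidalCategory.tensorHom_def, charTwist_whiskerRight,
    whiskerLeft_charTwist X.as ψ (L.toSkeleton_obj X), charTwist_add]

/-- The isomorphisms `e_g : g_*^L ≅ g_*^M` carry the tensor isomorphisms `b(g,h) φ^L(g,h)` to the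
tensor isomorphisms `φ^M(g,h)`. A natural isomorphism of functors on the discrete category `G` is
just such a family `e_g`, so `e` need not be monoidal; it is monoidal precisely when it is twisted
by `b = 0`. -/
def IsTwistedIso {L M : Lifting ρ} (b : G × G → charRep ρ) (e : L.functor ≅ M.functor) : Prop :=
  ∀ X Y : Discrete G, e.hom.app (X ⊗ Y) ≫ δ M.functor X Y =
    charTwist (b (X.as, Y.as)) (L.functor.obj (X ⊗ Y)) ≫ δ L.functor X Y ≫
      (e.hom.app X ⊗ₘ e.hom.app Y)

/-- The condition of `IsTwist` on simple objects is an equality of tensor natural transformations,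
as these are determined by their components at simple objects. -/
theorem isTwist_iff {β : groupCohomology (charRep ρ) 2} {L M : Lifting ρ} :
    IsTwist β L M ↔ ∃ (b : groupCohomology.cocycles₂ (charRep ρ)) (e : L.functor ≅ M.functor),
      groupCohomology.H2π (charRep ρ) b = β ∧ IsTwistedIso b e := by
  have key (b : groupCohomology.cocycles₂ (charRep ρ))
      (ψ : ∀ g, L.functor.obj ⟨g⟩ ≅ M.functor.obj ⟨g⟩) (g h : G) (X : C) (hX : Simple X) :
      charEval (b (g, h)) ((act L.functor (g * h)).obj X)
            (simple_functor_obj (L.functor.obj ⟨g * h⟩).obj hX) •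
          (actSplit L.functor g h X ≫ TensorAut.app ((ψ g).hom ⊗ₘ (ψ h).hom).hom X) =
      TensorAut.app (charTwist (b (g, h)) (L.functor.obj ⟨g * h⟩)).hom X ≫
        actSplit L.functor g h X ≫ TensorAut.app ((ψ g).hom ⊗ₘ (ψ h).hom).hom X := by
    rw [charTwist_app, charScale_simple _ (simple_functor_obj (L.functor.obj ⟨g * h⟩).obj hX),
      Linear.smul_comp, Category.id_comp]
    rfl
  constructor
  · rintro ⟨b, ψ, hb, h⟩
    refine ⟨b, Discrete.natIso fun X => ψ X.as, hb, fun X Y => ?_⟩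
    refine ObjectProperty.hom_ext _ (TensorAut.hom_ext_of_simple fun Z hZ => ?_)
    exact (h X.as Y.as Z hZ).trans (key b ψ X.as Y.as Z hZ)
  · rintro ⟨b, e, hb, h⟩
    refine ⟨b, fun g => e.app ⟨g⟩, hb, fun g k X hX => ?_⟩
    rw [key b (fun g => e.app ⟨g⟩) g k X hX]
    exact congrArg (fun t => TensorAut.app (InducedCategory.Hom.hom t) X) (h ⟨g⟩ ⟨k⟩)

namespace IsTwistedIso

variable {L M N : Lifting ρ}

theorem of_isMonoidal (e : L.functor ≅ M.functor) [NatTrans.IsMonoidal e.hom] :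
    IsTwistedIso (0 : G × G → charRep ρ) e := fun X Y => by
  rw [tensor_of_isMonoidal, Pi.zero_apply, charTwist_zero, Category.id_comp]

theorem isMonoidal {e : L.functor ≅ M.functor} (h : IsTwistedIso (0 : G × G → charRep ρ) e) :
    NatTrans.IsMonoidal e.hom :=
  isMonoidal_of_tensor e fun X Y => by
    rw [h X Y, Pi.zero_apply, charTwist_zero, Category.id_comp]

theorem trans {b c : G × G → charRep ρ} {e : L.functor ≅ M.functor} {e' : M.functor ≅ N.functor}
    (h : IsTwistedIso b e) (h' : IsTwistedIso c e') : IsTwistedIso (b + c) (e ≪≫ e') := by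
  intro X Y
  rw [Iso.trans_hom, NatTrans.comp_app, Category.assoc, h' X Y, charTwist_comm, reassoc_of% h X Y,
    tensorHom_comp_tensorHom, charTwist_comp_charTwist, add_comm]
  rfl

theorem symm {b : G × G → charRep ρ} {e : L.functor ≅ M.functor} (h : IsTwistedIso b e) :
    IsTwistedIso (-b) e.symm := by
  intro X Y
  rw [← cancel_epi (e.hom.app (X ⊗ Y)), charTwist_comm, reassoc_of% h X Y,
    tensorHom_comp_tensorHom, charTwist_comp_charTwist]
  simp

/-- Rescaling the isomorphism by a `1`-cochain changes the twist by its coboundary. -/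
theorem rescale {b : G × G → charRep ρ} {e : L.functor ≅ M.functor} (h : IsTwistedIso b e)
    {e' : L.functor ≅ M.functor} {x : G → charRep ρ}
    (he' : ∀ X, e'.hom.app X = charTwist (x X.as) (L.functor.obj X) ≫ e.hom.app X) :
    IsTwistedIso (b - groupCohomology.d₁₂ (charRep ρ) x) e' := by
  intro X Y
  rw [he', he', he', ← tensorHom_comp_tensorHom, L.charTwist_tensor, charTwist_comm,
    Category.assoc, h X Y, charTwist_comp_charTwist, charTwist_comp_charTwist]
  congr 2
  rw [Pi.sub_apply, groupCohomology.d₁₂_hom_apply]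
  dsimp
  abel

end IsTwistedIso

end TwistedIso

/-! ### Classification of liftings by cocycles -/

section Classification

open Functor.OplaxMonoidal

variable {C : Type u} [Category.{v} C] [Abelian C] [Linear ℂ C] [MonoidalCategory C]
  [MonoidalPreadditive C] [MonoidalLinear ℂ C] [IsFusionCategory C]
  {f : C} {σ : HalfBraiding f} {G : Type} [Group G] {ρ : G →* FermAutClasses σ}

/-- Liftings of the same `ρ` have isomorphic functors `g_*`, and for any choice of isomorphisms the
tensor isomorphisms differ by characters. -/
theorem Lifting.exists_isTwistedIso (L M : Lifting ρ) :
    ∃ (b : G × G → charRep ρ) (e : L.functor ≅ M.functor), IsTwistedIso b e := by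
  have hiso (X : Discrete G) : Nonempty (L.functor.obj X ≅ M.functor.obj X) :=
    Quotient.exact ((L.toSkeleton_obj X).trans (M.toSkeleton_obj X).symm)
  let e : L.functor ≅ M.functor := Discrete.natIso fun X => (hiso X).some
  have hex (X Y : Discrete G) := exists_charTwist_eq _ (L.toSkeleton_obj (X ⊗ Y))
    (e.hom.app (X ⊗ Y) ≫ δ M.functor X Y ≫ (e.inv.app X ⊗ₘ e.inv.app Y) ≫
      Functor.LaxMonoidal.μ L.functor X Y)
  choose b hb using hex
  refine ⟨fun p => b ⟨p.1⟩ ⟨p.2⟩, e, fun X Y => ?_⟩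
  change _ = charTwist (b X Y) _ ≫ _
  rw [hb]
  simp only [Category.assoc, Functor.Monoidal.μ_δ_assoc, tensorHom_comp_tensorHom,
    Iso.inv_hom_id_app, id_tensorHom_id, Category.comp_id]

/-- The cocycle condition comes from comparing the two composites `(ghk)_* → g_* h_* k_*`, which
agree for `L` and for `M`. -/
theorem IsTwistedIso.mem_cocycles₂ {L M : Lifting ρ} {b : G × G → charRep ρ}
    {e : L.functor ≅ M.functor} (h : IsTwistedIso b e) :
    b ∈ groupCohomology.cocycles₂ (charRep ρ) := by
  rw [groupCohomology.mem_cocycles₂_iff]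
  intro g k l
  let X : Discrete G := ⟨g⟩
  let Y : Discrete G := ⟨k⟩
  let Z : Discrete G := ⟨l⟩
  refine charTwist_injective _ (L.toSkeleton_obj ((X ⊗ Y) ⊗ Z)) ?_
  have h1 : e.hom.app ((X ⊗ Y) ⊗ Z) ≫ δ M.functor (X ⊗ Y) Z ≫
      δ M.functor X Y ▷ M.functor.obj Z ≫ (α_ _ _ _).hom =
      charTwist (b (g * k, l) + b (g, k)) (L.functor.obj ((X ⊗ Y) ⊗ Z)) ≫
        δ L.functor (X ⊗ Y) Z ≫ δ L.functor X Y ▷ L.functor.obj Z ≫ (α_ _ _ _).hom ≫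
          (e.hom.app X ⊗ₘ (e.hom.app Y ⊗ₘ e.hom.app Z)) := by
    have h3 : (e.hom.app (X ⊗ Y) ⊗ₘ e.hom.app Z) ≫ δ M.functor X Y ▷ M.functor.obj Z =
        charTwist (b (g, k)) (L.functor.obj (X ⊗ Y) ⊗ L.functor.obj Z) ≫
          δ L.functor X Y ▷ L.functor.obj Z ≫
            ((e.hom.app X ⊗ₘ e.hom.app Y) ⊗ₘ e.hom.app Z) := by
      rw [← charTwist_whiskerRight, ← tensorHom_id, tensorHom_comp_tensorHom, h X Y,
        ← tensorHom_id, ← tensorHom_id, tensorHom_comp_tensorHom, tensorHom_comp_tensorHom]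
      simp [X, Y]
    rw [reassoc_of% h (X ⊗ Y) Z, reassoc_of% h3, associator_naturality, charTwist_comm,
      charTwist_comp_charTwist]
    rfl
  have h2 : e.hom.app ((X ⊗ Y) ⊗ Z) ≫ M.functor.map (α_ X Y Z).hom ≫ δ M.functor X (Y ⊗ Z) ≫
      M.functor.obj X ◁ δ M.functor Y Z =
      charTwist ((charRep ρ).ρ g (b (k, l)) + b (g, k * l)) (L.functor.obj ((X ⊗ Y) ⊗ Z)) ≫
        L.functor.map (α_ X Y Z).hom ≫ δ L.functor X (Y ⊗ Z) ≫ L.functor.obj X ◁ δ L.functor Y Z ≫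
          (e.hom.app X ⊗ₘ (e.hom.app Y ⊗ₘ e.hom.app Z)) := by
    have h3 : (e.hom.app X ⊗ₘ e.hom.app (Y ⊗ Z)) ≫ M.functor.obj X ◁ δ M.functor Y Z =
        charTwist ((charRep ρ).ρ g (b (k, l))) (L.functor.obj X ⊗ L.functor.obj (Y ⊗ Z)) ≫
          L.functor.obj X ◁ δ L.functor Y Z ≫
            (e.hom.app X ⊗ₘ (e.hom.app Y ⊗ₘ e.hom.app Z)) := by
      rw [← whiskerLeft_charTwist g _ (L.toSkeleton_obj X), ← id_tensorHom,
        tensorHom_comp_tensorHom, h Y Z, ← id_tensorHom, ← id_tensorHom,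
        tensorHom_comp_tensorHom, tensorHom_comp_tensorHom]
      simp [Y, Z]
    rw [← e.hom.naturality_assoc, reassoc_of% h X (Y ⊗ Z), h3, charTwist_comm,
      charTwist_comm, charTwist_comm, charTwist_comp_charTwist, add_comm]
    rfl
  have hL := Functor.OplaxMonoidal.associativity L.functor X Y Z
  rw [Functor.OplaxMonoidal.associativity, h2, ← reassoc_of% hL] at h1
  -- Both sides now are twists followed by the same isomorphism `T`.
  let T : L.functor.obj ((X ⊗ Y) ⊗ Z) ≅ _ := asIso (δ L.functor (X ⊗ Y) Z ≫
    δ L.functor X Y ▷ L.functor.obj Z ≫ (α_ _ _ _).hom ≫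
          (e.hom.app X ⊗ₘ (e.hom.app Y ⊗ₘ e.hom.app Z)))
  exact (cancel_mono T.hom).1 h1.symm

/-- The oplax monoidal structure with comparison morphisms `b(g,h) φ(g,h)`. Its associativity is the
cocycle condition for `b`. -/
@[reducible]
noncomputable def Lifting.twistOplax (L : Lifting ρ)
    (b : groupCohomology.cocycles₂ (charRep ρ)) : L.functor.OplaxMonoidal where
  -- The cocycle need not be normalized, so the unit constraint has to absorb `b(1,1)`.
  η := charTwist (-b (1, 1)) (L.functor.obj (𝟙_ _)) ≫ η L.functor
  δ X Y := charTwist (b (X.as, Y.as)) (L.functor.obj (X ⊗ Y)) ≫ δ L.functor X Y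
  δ_natural_left {X Y} t Z := by
    obtain rfl : X = Y := Discrete.ext (Discrete.eq_of_hom t)
    obtain rfl : t = 𝟙 _ := Subsingleton.elim _ _
    simp
  δ_natural_right {X Y} Z t := by
    obtain rfl : X = Y := Discrete.ext (Discrete.eq_of_hom t)
    obtain rfl : t = 𝟙 _ := Subsingleton.elim _ _
    simp
  oplax_associativity X Y Z := by
    have hb := (groupCohomology.mem_cocycles₂_iff _).1 b.2 X.as Y.as Z.as
    rw [comp_whiskerRight, MonoidalCategory.whiskerLeft_comp, charTwist_whiskerRight,
      whiskerLeft_charTwist X.as _ (L.toSkeleton_obj X)]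
    simp only [Category.assoc]
    rw [charTwist_comm, charTwist_comp_charTwist, charTwist_comm, charTwist_comm,
      charTwist_comm, charTwist_comp_charTwist, Functor.OplaxMonoidal.associativity]
    congr 2
    exact hb.trans (add_comm _ _)
  oplax_left_unitality X := by
    rw [comp_whiskerRight, charTwist_whiskerRight, Category.assoc, charTwist_comm,
      charTwist_comm, charTwist_comm, charTwist_comp_charTwist]
    have hb : b ((𝟙_ (Discrete G)).as, X.as) + -b (1, 1) = 0 := by
      rw [add_neg_eq_zero]
      exact groupCohomology.cocycles₂_map_one_fst b X.as
    rw [hb, charTwist_zero, Category.id_comp, ← Functor.OplaxMonoidal.left_unitality]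
  oplax_right_unitality X := by
    rw [MonoidalCategory.whiskerLeft_comp, whiskerLeft_charTwist X.as _ (L.toSkeleton_obj X),
      Category.assoc, charTwist_comm, charTwist_comm, charTwist_comm, charTwist_comp_charTwist]
    have hb : b (X.as, (𝟙_ (Discrete G)).as) + (charRep ρ).ρ X.as (-b (1, 1)) = 0 := by
      rw [map_neg, add_neg_eq_zero]
      exact groupCohomology.cocycles₂_map_one_snd b X.as
    rw [hb, charTwist_zero, Category.id_comp, ← Functor.OplaxMonoidal.right_unitality]

instance isIso_charTwist (χ : charRep ρ) (F : FermAut σ) : IsIso (charTwist χ F) :=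
  ⟨charTwist (-χ) F, by rw [← charTwist_add, add_neg_cancel, charTwist_zero],
    by rw [← charTwist_add, neg_add_cancel, charTwist_zero]⟩

/-- The twist of a lifting by a `2`-cocycle `b`: the functors are the same and `φ(g,h)` is replaced
by `b(g,h) φ(g,h)`. -/
noncomputable def Lifting.twist (L : Lifting ρ) (b : groupCohomology.cocycles₂ (charRep ρ)) :
    Lifting ρ where
  functor := L.functor
  monoidal :=
    haveI h1 : IsIso (charTwist (-b (1, 1)) (L.functor.obj (𝟙_ _)) ≫ η L.functor) :=
      inferInstance
    haveI h2 (X Y : Discrete G) : IsIso (charTwist (b (X.as, Y.as)) (L.functor.obj (X ⊗ Y)) ≫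
      δ L.functor X Y) := inferInstance
    @Functor.Monoidal.ofOplaxMonoidal _ _ _ _ _ _ L.functor (L.twistOplax b) h1 h2
  lifts := L.lifts

theorem Lifting.isTwistedIso_twist (L : Lifting ρ) (b : groupCohomology.cocycles₂ (charRep ρ)) :
    IsTwistedIso (L := L) (M := L.twist b) b (Iso.refl L.functor) := by
  intro X Y
  have h : δ (L.twist b).functor X Y =
      charTwist (b (X.as, Y.as)) (L.functor.obj (X ⊗ Y)) ≫ δ L.functor X Y := rfl
  rw [h, Iso.refl_hom, NatTrans.id_app, NatTrans.id_app, NatTrans.id_app]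
  erw [id_tensorHom_id, Category.id_comp, Category.comp_id]
  rfl

end Classification

/-! ### The restriction to the fermion -/

section Theta

open Functor.OplaxMonoidal

/-- The map on `H²` induced by a morphism of representations, in terms of cocycles. -/
theorem map_H2π {k : Type} [CommRing k] {G : Type} [Group G] {A B : Rep k G} (φ : A ⟶ B)
    (b : groupCohomology.cocycles₂ A) :
    ∃ hb : (fun p => φ.hom (b p)) ∈ groupCohomology.cocycles₂ B,
      groupCohomology.map (MonoidHom.id G) φ 2 (groupCohomology.H2π A b) =
        groupCohomology.H2π B ⟨fun p => φ.hom (b p), hb⟩ :=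
  ⟨(groupCohomology.mapCocycles₂ (A := A) (B := B) (MonoidHom.id G) φ b).2,
    groupCohomology.H2π_comp_map_apply (A := A) (B := B) (MonoidHom.id G) φ b⟩

theorem neg_one_pow_val_add (a b : ZMod 2) :
    (-1 : ℂ) ^ (a + b).val = (-1) ^ a.val * (-1) ^ b.val := by
  rw [← pow_add, neg_one_pow_eq_pow_mod_two, neg_one_pow_eq_pow_mod_two (n := a.val + b.val),
    ZMod.val_add, Nat.mod_mod]

theorem neg_one_pow_val_injective {a b : ZMod 2} (h : (-1 : ℂ) ^ a.val = (-1) ^ b.val) :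
    a = b := by
  have hz (a : ZMod 2) : a = 0 ∨ a = 1 := by revert a; decide
  have hne : (1 : ℂ) ≠ -1 := by norm_num
  rcases hz a with rfl | rfl <;> rcases hz b with rfl | rfl <;>
    simp [ZMod.val_one, hne, hne.symm] at h ⊢

variable {C : Type u} [Category.{v} C] [Abelian C] [Linear ℂ C] [MonoidalCategory C]
  [MonoidalPreadditive C] [MonoidalLinear ℂ C] [IsFusionCategory C]
  {f : C} {σ : HalfBraiding f} {G : Type} [Group G] {ρ : G →* FermAutClasses σ}

theorem RestrictionCochain.exists_sign (hf : IsFermion σ) {L : Discrete G ⥤ FermAut σ}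
    [L.Monoidal] (T T' : RestrictionCochain L) (g : G) :
    ∃ x : ZMod 2, (T'.u g).hom = (-1 : ℂ) ^ x.val • (T.u g).hom := by
  obtain ⟨s, hs⟩ := exists_smul_eq hf.simple (T'.u g) (T.u g)
  rcases hf.sq_eq_one_of_trivialization (T'.tensor g) (T.tensor g) hs with rfl | rfl
  · exact ⟨0, by simpa using! hs⟩
  · exact ⟨1, by simpa [ZMod.val_one] using! hs⟩

/-- The class `θ` does not depend on the choice of the tensor isomorphisms `ξ_g`. -/
theorem IsFermion.theta_eq (hf : IsFermion σ) {L : Discrete G ⥤ FermAut σ} [L.Monoidal]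
    (T : RestrictionCochain L) :
    hf.theta L = groupCohomology.H2π (zmodTwoRep G) ⟨T.c, T.mem_cocycles₂ hf⟩ := by
  unfold IsFermion.theta
  rw [groupCohomology.H2π_eq_iff]
  choose x hx using T.exists_sign hf (hf.nonempty_restrictionCochain L).some
  refine ⟨x, funext fun ⟨g, h⟩ => ?_⟩
  change x h - x (g * h) + x g = (hf.nonempty_restrictionCochain L).some.c (g, h) - T.c (g, h)
  generalize (hf.nonempty_restrictionCochain L).some = T' at hx ⊢
  suffices hc : x (g * h) + T.c (g, h) = T'.c (g, h) + (x h + x g) by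
    have h2 (a : ZMod 2) : a + a = 0 := CharTwo.add_self_eq_zero a
    linear_combination hc + h2 (x h) + h2 (x g) - h2 (x (g * h))
  apply neg_one_pow_val_injective
  let w : (act L (g * h)).obj f ≅ f := compositeIso L T.u g h
  have hw : w.hom = actSplit L g h f ≫ (act L g).map (T.u h).hom ≫ (T.u g).hom := rfl
  apply smul_hom_injective hf.simple w
  calc _ = (T'.u (g * h)).hom := by
        rw [hx, T.compare, neg_one_pow_val_add, mul_smul, hw]
    _ = _ := by
        rw [T'.compare, hx h, hx g, neg_one_pow_val_add, neg_one_pow_val_add, mul_smul, mul_smul,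
          hw]
        simp only [Functor.map_smul, Linear.smul_comp, Linear.comp_smul]
        rw [smul_comm ((-1 : ℂ) ^ (x h).val)]

theorem IsFermion.charScale_fermion (hf : IsFermion σ) (χ : Additive (K0hat C)) :
    charScale χ.toMul f = (-1 : ℂ) ^ (hf.restrictHom χ).val • 𝟙 f := by
  classical
  rw [charScale_simple _ hf.simple]
  congr 1
  change (χ.toMul.1 hf.cls : ℂ) =
    (-1) ^ (if χ.toMul.1 hf.cls = 1 then (0 : ZMod 2) else 1).val
  split_ifs with h
  · rw [h]
    simp
  · have h2 := congrArg Units.val (hf.char_sq χ.toMul)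
    rcases mul_self_eq_one_iff.1 h2 with h3 | h3
    · exact absurd (Units.ext h3) h
    · rw [h3]
      simp [ZMod.val_one]

theorem IsFermion.charScale_comp (hf : IsFermion σ) (χ : Additive (K0hat C)) {X : C} (w : X ⟶ f) :
    charScale χ.toMul X ≫ w = (-1 : ℂ) ^ (hf.restrictHom χ).val • w := by
  rw [← charScale_naturality, hf.charScale_fermion, Linear.comp_smul, Category.comp_id]

/-- Trivializations of the restriction of `M` to `⟨f⟩` can be transported along a twisted
isomorphism from `L` to `M`; the twist `b` contributes its restriction `r(b)` to the cochain. -/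
noncomputable def IsTwistedIso.transport (hf : IsFermion σ) {L M : Lifting ρ}
    {b : G × G → charRep ρ} {e : L.functor ≅ M.functor} (h : IsTwistedIso b e)
    (T : RestrictionCochain M.functor) : RestrictionCochain L.functor where
  u g := (TensorAut.Hom.iso (e.hom.app ⟨g⟩).hom).app f ≪≫ T.u g
  tensor g := IsTensorTrivialization.of_nat (e.hom.app ⟨g⟩).hom (T.tensor g) rfl
  c p := T.c p + hf.restrictHom (b p)
  compare g k := by
    change TensorAut.app (e.hom.app ⟨g * k⟩).hom f ≫ (T.u (g * k)).hom = _ • (_ ≫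
      (act L.functor g).map (TensorAut.app (e.hom.app ⟨k⟩).hom f ≫ (T.u k).hom) ≫
        TensorAut.app (e.hom.app ⟨g⟩).hom f ≫ (T.u g).hom)
    have h1 : TensorAut.app (e.hom.app ⟨g * k⟩).hom f ≫ actSplit M.functor g k f =
        charScale (Additive.toMul (α := K0hat C) (b (g, k))) ((act L.functor (g * k)).obj f) ≫
          actSplit L.functor g k f ≫ TensorAut.app (e.hom.app ⟨g⟩).hom _ ≫
            (act M.functor g).map (TensorAut.app (e.hom.app ⟨k⟩).hom f) :=
      congrArg (fun t => TensorAut.app (InducedCategory.Hom.hom t) f) (h ⟨g⟩ ⟨k⟩)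
    rw [T.compare, Linear.comp_smul, reassoc_of% h1]
    refine (congrArg _ (hf.charScale_comp (b (g, k)) _)).trans ?_
    rw [smul_smul, ← neg_one_pow_val_add]
    have h2 : TensorAut.app (e.hom.app ⟨g⟩).hom ((act L.functor k).obj f) ≫
        (act M.functor g).map (TensorAut.app (e.hom.app ⟨k⟩).hom f) ≫
          (act M.functor g).map (T.u k).hom =
        (act L.functor g).map (TensorAut.app (e.hom.app ⟨k⟩).hom f ≫ (T.u k).hom) ≫
          TensorAut.app (e.hom.app ⟨g⟩).hom f := by
      rw [← Functor.map_comp]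
      exact (TensorAut.naturality (e.hom.app ⟨g⟩).hom _).symm
    rw [← reassoc_of% h2]

theorem IsFermion.restrictH2_H2π (hf : IsFermion σ) (b : groupCohomology.cocycles₂ (charRep ρ)) :
    ∃ hb : (fun p => hf.restrictHom (b p)) ∈ groupCohomology.cocycles₂ (zmodTwoRep G),
      hf.restrictH2 ρ (groupCohomology.H2π (charRep ρ) b) =
        groupCohomology.H2π (zmodTwoRep G) ⟨fun p => hf.restrictHom (b p), hb⟩ := by
  exact map_H2π (hf.restrict ρ) b

/-- Twisting by `β` changes `θ` by `r_* β`; the side of the equation on which `r_* β` stands does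
not matter, as `H²(G, ℤ/2ℤ)` is `2`-torsion. -/
theorem IsTwist.theta_eq (hf : IsFermion σ) {β : groupCohomology (charRep ρ) 2} {L M : Lifting ρ}
    (h : IsTwist β L M) : hf.theta L.functor = hf.theta M.functor + hf.restrictH2 ρ β := by
  obtain ⟨b, e, rfl, hbe⟩ := isTwist_iff.1 h
  let T := (hf.nonempty_restrictionCochain M.functor).some
  obtain ⟨hb, hb2⟩ := hf.restrictH2_H2π b
  rw [hf.theta_eq (hbe.transport hf T), hf.theta_eq T, hb2, ← map_add]
  rfl

end Theta

/-! ### The torsor of liftings and the obstruction -/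

section Torsor

open Functor.OplaxMonoidal

variable {C : Type u} [Category.{v} C] [Abelian C] [Linear ℂ C] [MonoidalCategory C]
  [MonoidalPreadditive C] [MonoidalLinear ℂ C] [IsFusionCategory C]
  {f : C} {σ : HalfBraiding f} {G : Type} [Group G] {ρ : G →* FermAutClasses σ}

theorem IsTwistedIso.cochain_unique {L M : Lifting ρ} {b c : G × G → charRep ρ}
    {e : L.functor ≅ M.functor} (hb : IsTwistedIso b e) (hc : IsTwistedIso c e) : b = c := by
  funext ⟨g, h⟩
  refine charTwist_injective _ (L.toSkeleton_obj ((⟨g⟩ : Discrete G) ⊗ ⟨h⟩)) ?_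
  have key := (hb ⟨g⟩ ⟨h⟩).symm.trans (hc ⟨g⟩ ⟨h⟩)
  exact (cancel_mono (δ L.functor ⟨g⟩ ⟨h⟩ ≫ (e.hom.app ⟨g⟩ ⊗ₘ e.hom.app ⟨h⟩))).1 key

/-- A self-isomorphism is given by characters `x g`, so the twist that it realizes is the
coboundary of `-x`. -/
theorem IsTwistedIso.mem_coboundaries₂ {L : Lifting ρ} {b : G × G → charRep ρ}
    {e : L.functor ≅ L.functor} (h : IsTwistedIso b e) :
    b ∈ groupCohomology.coboundaries₂ (charRep ρ) := by
  choose x hx using fun g : G => exists_charTwist_eq g (L.lifts g) (e.hom.app ⟨g⟩)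
  have h0 : IsTwistedIso (0 : G × G → charRep ρ) (Iso.refl L.functor) :=
    haveI : NatTrans.IsMonoidal (Iso.refl L.functor).hom :=
      inferInstanceAs (NatTrans.IsMonoidal (𝟙 L.functor))
    .of_isMonoidal _
  have h1 := h0.rescale (e' := e) (x := x) fun X => by
    rw [Iso.refl_hom, NatTrans.id_app, Category.comp_id]
    exact (hx X.as).symm
  rw [h.cochain_unique h1, zero_sub]
  exact neg_mem ⟨x, rfl⟩

namespace IsTwist

variable {L M N : Lifting ρ} {β γ : groupCohomology (charRep ρ) 2}

theorem zero_iff : IsTwist (0 : groupCohomology (charRep ρ) 2) L M ↔ L.Equivalent M := by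
  rw [isTwist_iff]
  constructor
  · rintro ⟨b, e, hb, h⟩
    obtain ⟨x, hx⟩ := (groupCohomology.H2π_eq_zero_iff b).1 hb
    let e' : L.functor ≅ M.functor := Discrete.natIso fun X =>
      asIso (charTwist (x X.as) (L.functor.obj X)) ≪≫ e.app X
    have h1 := h.rescale (e' := e') (x := x) fun X => rfl
    have hz : ⇑b - groupCohomology.d₁₂ (charRep ρ) x = 0 := sub_eq_zero.2 hx.symm
    rw [hz] at h1
    exact ⟨e', h1.isMonoidal⟩
  · rintro ⟨e, he⟩
    exact ⟨0, e, map_zero _, .of_isMonoidal e⟩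

theorem trans (h : IsTwist β L M) (h' : IsTwist γ M N) : IsTwist (β + γ) L N := by
  obtain ⟨b, e, rfl, hb⟩ := isTwist_iff.1 h
  obtain ⟨c, e', rfl, hc⟩ := isTwist_iff.1 h'
  exact isTwist_iff.2 ⟨b + c, e ≪≫ e', map_add _ _ _, hb.trans hc⟩

theorem symm (h : IsTwist β L M) : IsTwist (-β) M L := by
  obtain ⟨b, e, rfl, hb⟩ := isTwist_iff.1 h
  exact isTwist_iff.2 ⟨-b, e.symm, map_neg _ _, hb.symm⟩

theorem eq_zero (h : IsTwist β L L) : β = 0 := by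
  obtain ⟨b, e, rfl, hb⟩ := isTwist_iff.1 h
  exact (groupCohomology.H2π_eq_zero_iff b).2 hb.mem_coboundaries₂

theorem unique (h : IsTwist β L M) (h' : IsTwist γ L M) : β = γ := by
  rw [← sub_eq_zero, sub_eq_add_neg]
  exact (h.trans h'.symm).eq_zero

theorem congr (h : IsTwist β L M) {L' M' : Lifting ρ} (hL : L.Equivalent L')
    (hM : M.Equivalent M') : IsTwist β L' M' := by
  have h1 := ((zero_iff.2 hL).symm.trans h).trans (zero_iff.2 hM)
  rwa [neg_zero, zero_add, add_zero] at h1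

theorem equivalent (h : IsTwist β L M) (h' : IsTwist β L N) : M.Equivalent N := by
  rw [← zero_iff, ← neg_add_cancel β]
  exact h.symm.trans h'

end IsTwist

theorem Lifting.exists_isTwist (L M : Lifting ρ) : ∃ β, IsTwist β L M := by
  obtain ⟨b, e, h⟩ := L.exists_isTwistedIso M
  exact ⟨_, isTwist_iff.2 ⟨⟨b, h.mem_cocycles₂⟩, e, rfl, h⟩⟩

theorem Lifting.exists_twist (L : Lifting ρ) (β : groupCohomology (charRep ρ) 2) :
    ∃ M, IsTwist β L M := by
  induction β using groupCohomology.H2_induction_on with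
  | h b => exact ⟨L.twist b, isTwist_iff.2 ⟨b, Iso.refl _, rfl, L.isTwistedIso_twist b⟩⟩

namespace IsFermion

theorem restrictH2_eq_zero (hf : IsFermion σ) (h : hf.RestrictTrivial)
    (β : groupCohomology (charRep ρ) 2) : hf.restrictH2 ρ β = 0 := by
  induction β using groupCohomology.H2_induction_on with
  | h b =>
    obtain ⟨hb, hb2⟩ := hf.restrictH2_H2π b
    have h0 : (⟨fun p => hf.restrictHom (b p), hb⟩ :
        groupCohomology.cocycles₂ (zmodTwoRep G)) = 0 :=
      Subtype.ext (funext fun p => DFunLike.congr_fun h (b p))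
    rw [hb2, h0, map_zero]

/-- Exactness of the long cohomology sequence at `H²(G, ℤ/2ℤ)`. -/
theorem connecting_eq_zero_iff (hf : IsFermion σ) (ρ : G →* FermAutClasses σ)
    (h : ¬ hf.RestrictTrivial) (x : groupCohomology (zmodTwoRep G) 2) :
    hf.connecting ρ h x = 0 ↔ ∃ β, hf.restrictH2 ρ β = x := by
  have hex := groupCohomology.mapShortComplex₃_exact (hf.restrictSequence_shortExact ρ h)
    (i := 2) (j := 3) rfl
  constructor
  · exact fun hx => (ShortComplex.moduleCat_exact_iff _).1 hex x hx
  · rintro ⟨β, rfl⟩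
    exact (groupCohomology.mapShortComplex₃ (hf.restrictSequence_shortExact ρ h)
      (i := 2) (j := 3) rfl).moduleCat_zero_apply β

end IsFermion

theorem obstruction_eq (hf : IsFermion σ) (α : groupCohomology (zmodTwoRep G) 2)
    (L M : Lifting ρ) : obstruction hf M α = obstruction hf L α := by
  obtain ⟨β, hβ⟩ := M.exists_isTwist L
  have hθ := hβ.theta_eq hf
  unfold obstruction
  split_ifs with h
  · rw [hθ, hf.restrictH2_eq_zero h, add_zero]
  · rw [hθ, add_sub_right_comm, map_add, (hf.connecting_eq_zero_iff ρ h _).2 ⟨β, rfl⟩, add_zero]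

theorem obstructionVanishes_iff (hf : IsFermion σ) (α : groupCohomology (zmodTwoRep G) 2)
    (L : Lifting ρ) : ObstructionVanishes (obstruction hf L α) ↔
      ∃ β, hf.restrictH2 ρ β = hf.theta L.functor - α := by
  unfold ObstructionVanishes obstruction
  split_ifs with h
  · simp only [Sum.inl.injEq, reduceCtorEq, or_false, hf.restrictH2_eq_zero h, exists_const]
    exact eq_comm
  · simp only [Sum.inr.injEq, reduceCtorEq, false_or]
    exact hf.connecting_eq_zero_iff ρ h _

/-- The classes `θ` of the liftings of `ρ` are those that differ from `θ_L` by an element of the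
image of `r_*`. -/
theorem nonempty_alphaLifting_iff (hf : IsFermion σ) (α : groupCohomology (zmodTwoRep G) 2)
    (L : Lifting ρ) : Nonempty (AlphaLifting hf ρ α) ↔
      ∃ β, hf.restrictH2 ρ β = hf.theta L.functor - α := by
  constructor
  · rintro ⟨M, rfl⟩
    obtain ⟨β, hβ⟩ := L.exists_isTwist M
    exact ⟨β, by rw [hβ.theta_eq hf, add_sub_cancel_left]⟩
  · rintro ⟨β, hβ⟩
    obtain ⟨M, hM⟩ := L.exists_twist β
    refine ⟨M, ?_⟩
    have h := hM.theta_eq hf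
    rw [hβ, add_sub_left_comm, left_eq_add, sub_eq_zero] at h
    exact h

section Action

variable (hf : IsFermion σ) (ρ) (α : groupCohomology (zmodTwoRep G) 2)

theorem AlphaLifting.exists_twist (β : LinearMap.ker (hf.restrictH2 ρ).hom)
    (M : AlphaLifting hf ρ α) : ∃ N : AlphaLifting hf ρ α, IsTwist β.1 M.1 N.1 := by
  obtain ⟨N, hN⟩ := M.1.exists_twist β.1
  have h0 : hf.restrictH2 ρ β.1 = 0 := β.2
  refine ⟨⟨N, ?_⟩, hN⟩
  have h := hN.theta_eq hf
  rw [h0, add_zero] at h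
  rw [← h, M.2]

/-- The class of `β ▷ M` for a class of `α`-liftings `[M]`. -/
noncomputable def twistClass (β : LinearMap.ker (hf.restrictH2 ρ).hom)
    (x : AlphaLiftingClasses hf ρ α) : AlphaLiftingClasses hf ρ α :=
  Quotient.mk _ (AlphaLifting.exists_twist ρ hf α β x.out).choose

theorem twistClass_mk_eq_mk_iff (β : LinearMap.ker (hf.restrictH2 ρ).hom)
    (M N : AlphaLifting hf ρ α) :
    twistClass ρ hf α β (Quotient.mk _ M) = Quotient.mk _ N ↔ IsTwist β.1 M.1 N.1 := by
  let x : AlphaLiftingClasses hf ρ α := Quotient.mk _ M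
  have h1 : x.out.1.Equivalent M.1 := Quotient.mk_out (s := alphaLiftingSetoid hf ρ α) M
  have h2 := (AlphaLifting.exists_twist ρ hf α β x.out).choose_spec
  refine Quotient.eq.trans ⟨fun h => h2.congr h1 h, fun h => ?_⟩
  exact (h2.congr h1 ((alphaLiftingSetoid hf ρ α).refl _)).equivalent h

/-- Twisting as an action of `Ker r_*` on the classes of `α`-liftings. -/
noncomputable abbrev twistAction :
    AddAction (LinearMap.ker (hf.restrictH2 ρ).hom) (AlphaLiftingClasses hf ρ α) where
  vadd := twistClass ρ hf α
  zero_vadd x := by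
    induction x using Quotient.inductionOn with
    | h M =>
      exact (twistClass_mk_eq_mk_iff ρ hf α 0 M M).2
        (IsTwist.zero_iff.2 ((alphaLiftingSetoid hf ρ α).refl M))
  add_vadd β γ x := by
    induction x using Quotient.inductionOn with
    | h M =>
      obtain ⟨N, hN⟩ := AlphaLifting.exists_twist ρ hf α γ M
      obtain ⟨P, hP⟩ := AlphaLifting.exists_twist ρ hf α β N
      change twistClass ρ hf α _ _ = twistClass ρ hf α β (twistClass ρ hf α γ _)
      rw [(twistClass_mk_eq_mk_iff ρ hf α γ M N).2 hN,
        (twistClass_mk_eq_mk_iff ρ hf α β N P).2 hP, twistClass_mk_eq_mk_iff, add_comm]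
      exact hN.trans hP

end Action

end Torsor

end Fermionic

theorem mainTheorem3 {C : Type u} [Category.{v} C] [Abelian C] [Linear ℂ C] [MonoidalCategory C]
    [MonoidalPreadditive C] [MonoidalLinear ℂ C] [IsFusionCategory C]
    {f : C} {σ : HalfBraiding f} (hf : IsFermion σ) {G : Type} [Group G]
    (α : groupCohomology (zmodTwoRep G) 2)
    (ρ : G →* FermAutClasses σ) (L : Lifting ρ) :
    (∀ M : Lifting ρ, obstruction hf M α = obstruction hf L α) ∧
    (Nonempty (AlphaLifting hf ρ α) ↔ ObstructionVanishes (obstruction hf L α)) ∧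
    (∃ _ : AddAction (LinearMap.ker (hf.restrictH2 ρ).hom) (AlphaLiftingClasses hf ρ α),
      (∀ (β : LinearMap.ker (hf.restrictH2 ρ).hom) (M N : AlphaLifting hf ρ α),
        β +ᵥ (Quotient.mk _ M : AlphaLiftingClasses hf ρ α) = Quotient.mk _ N ↔
          IsTwist β.1 M.1 N.1) ∧
      ∀ x y : AlphaLiftingClasses hf ρ α, ∃! β : LinearMap.ker (hf.restrictH2 ρ).hom,
        β +ᵥ x = y) := by
  refine ⟨obstruction_eq hf α L, ?_, twistAction ρ hf α, twistClass_mk_eq_mk_iff ρ hf α, ?_⟩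
  · rw [nonempty_alphaLifting_iff hf α L, obstructionVanishes_iff]
  · intro x y
    induction x using Quotient.inductionOn with
    | h M =>
    induction y using Quotient.inductionOn with
    | h N =>
    obtain ⟨β, hβ⟩ := M.1.exists_isTwist N.1
    have hθ := hβ.theta_eq hf
    rw [M.2, N.2, left_eq_add] at hθ
    refine ⟨⟨β, hθ⟩, (twistClass_mk_eq_mk_iff ρ hf α _ M N).2 hβ, fun γ hγ => ?_⟩
    exact Subtype.ext (((twistClass_mk_eq_mk_iff ρ hf α γ M N).1 hγ).unique hβ)
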